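/- A polarization of a complex abelian variety $X=V/\Lambda$ is identified with the corresponding integral alternating form $L_X$ on $H_1(X,\mathbb Z)=\Lambda$ (the imaginary part of a positive definite Hermitian form on $V$). Let $D=(d_1\mid\dots\mid d_n)$, $D'=(d'_1\mid\dots\mid d'_{n'})$ and $E=(e_1\mid\dots\mid e_{n+n'})$ be types of polarizations (sequences of positive integers), and put $\delta=(D,D',E)$. A symplectic basis $\lambda_1,\dots,\lambda_{2n}$ for a polarization of type $D$ is a basis of $H_1(X,\mathbb Z)$ with $L_X(\lambda_i,\lambda_{i+n})=d_i=-L_X(\lambda_{i+n},\lambda_i)$ and $L_X(\lambda_i,\lambda_j)=0$ in all other cases. Let $\mathcal A'_D$ be the collection of isomorphism classes of abelian varieties endowed with a symplectic basis for a polarization of type $D$, the isomorphisms being required to preserve polarizations and bases. Let $M:\mathbb Z^{2n}\times\mathbb Z^{2n'}\to\mathbb Z^{2(n+n')}$ be an integer matrix. An embedding of type $(\delta,M)$ with symplectic bases consists of abelian varieties $X,X',Y$ with symplectic bases for polarizations $L_X,L_{X'},L_Y$ of types $D,D',E$, and of an isogeny $s:X\times X'\to Y$ such that the restrictions $e:X\to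 Y$ and $e':X'\to Y$ of $s$ are embeddings, $L_X=e^*L_Y$, $L_{X'}=e'^*L_Y$, $s^*L_Y=p^*L_X\otimes p'^*L_{X'}$ (where $p,p'$ are the projections of $X\times X'$), and $s_*:H_1(X\times X',\mathbb Z)\to H_1(Y,\mathbb Z)$ has matrix $M$ with respect to the bases. (The underlying embedding is $e$.) Two such data $s:X\times X'\to Y$ and $t:X_1\times X_1'\to Y_1$ are isomorphic if there are isomorphisms $u:X\to X_1$, $u':X'\to X_1'$, $v:Y\to Y_1$ preserving polarizations and bases with $t\circ(u\times u')=v\circ s$. Let $\mathcal E'_\delta(M)$ be the collection of isomorphism classes of such data. The datum $(\delta,M)$ is called a type of embeddings if $\mathcal E'_\delta(M)$ is nonempty. **Proposition.** Let $(\delta,M)$ be a type of embeddings. The map which sends the class of $s:X\times X'\to Y$ to the pair of the classes of $X$ and of $X'$ (with their bases) is a bijection $$\mathcal E'_\delta(M)\longleftrightarrow\mathcal A'_D\times\mathcal A'_{D'}.$$ Its inverse is obtained as follows. Let abelian varieties $X,X'$ with symplectic bases for polarizations of types $D,D'$ be given. By means of the isomorphism $H_1(X\times X',\mathbb Z)\cong\mathbb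 Z^{2n}\times\mathbb Z^{2n'}$ given by the bases, the points of $X\times X'$ whose real coordinates $x$ satisfy $Mx\in\mathbb Z^{2(n+n')}$ form a finite subgroup $F\subset X\times X'$, and $F$ is isomorphic to $\operatorname{Coker}(M)$, the point with coordinates $x$ corresponding to the class of $Mx$. There is a symplectic basis for a polarization of type $E$ on $Y=(X\times X')/F$ such that the quotient map $s:X\times X'\to Y$ is an embedding of type $(\delta,M)$ with symplectic bases, in the sense above; in particular the restriction $X\to Y$ of $s$ is an embedding of the given type. The class of this $s$ is the element of $\mathcal E'_\delta(M)$ that corresponds to the classes of $X$ and $X'$. -/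

import Mathlib

open Filter Topology Module
open scoped Matrix

universe u

noncomputable section

/-! ### Complex tori and their morphisms -/

/-- A complex torus `V / Λ`: a finite dimensional complex vector space `V` and a full lattice `Λ`
in it. The lattice is identified with `H₁(V / Λ, ℤ)`, as usual. The norm on `V` only serves to
carry the topology of a finite dimensional space. -/
structure ComplexTorus where
  V : Type u
  [normed : NormedAddCommGroup V]
  [space : NormedSpace ℂ V]
  [findim : FiniteDimensional ℂ V]
  Λ : Submodule ℤ V
  [discrete : DiscreteTopology Λ]
  [lattice : IsZLattice ℝ Λ]

namespace ComplexTorus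

attribute [instance] normed space findim discrete lattice

/-- The group of points of the torus, with the quotient topology. -/
abbrev Pts (T : ComplexTorus.{u}) : Type u := T.V ⧸ T.Λ

/-- The universal covering map `V → V / Λ`. -/
abbrev proj (T : ComplexTorus.{u}) : T.V →ₗ[ℤ] T.Pts := T.Λ.mkQ

theorem proj_eq_proj_iff (T : ComplexTorus.{u}) {v w : T.V} :
    T.proj v = T.proj w ↔ v - w ∈ T.Λ := by
  simpa using Submodule.Quotient.eq T.Λ (x := v) (y := w)

theorem proj_eq_zero_iff (T : ComplexTorus.{u}) {v : T.V} : T.proj v = 0 ↔ v ∈ T.Λ := by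
  simp

instance isClosed_lattice (T : ComplexTorus.{u}) : IsClosed (T.Λ : Set T.V) :=
  @AddSubgroup.isClosed_of_discrete _ _ _ _ _ T.Λ.toAddSubgroup
    (inferInstanceAs (DiscreteTopology T.Λ))

instance t2Space_pts (T : ComplexTorus.{u}) : T2Space T.Pts := inferInstance

/-- A map between complex tori is holomorphic if locally it is induced by holomorphic maps between
the universal covers (whose restrictions to small open sets are the charts of the tori). -/
def IsHolomorphic {X Y : ComplexTorus.{u}} (f : X.Pts → Y.Pts) : Prop :=
  ∀ v : X.V, ∃ U ∈ 𝓝 v, ∃ g : X.V → Y.V,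
    DifferentiableOn ℂ g U ∧ ∀ x ∈ U, f (X.proj x) = Y.proj (g x)

/-- A morphism of complex tori: a homomorphism of complex analytic groups. -/
structure Hom (X Y : ComplexTorus.{u}) extends X.Pts →+ Y.Pts where
  holomorphic : IsHolomorphic toFun

namespace Hom

variable {X Y Z : ComplexTorus.{u}}

instance : CoeFun (Hom X Y) (fun _ => X.Pts → Y.Pts) := ⟨fun f => f.toFun⟩

theorem exists_lift (f : Hom X Y) :
    ∃ F : X.V →L[ℂ] Y.V, ∀ v, f (X.proj v) = Y.proj (F v) := by
  obtain ⟨U, hU, g, hg, hfg⟩ := f.holomorphic 0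
  have hg0 : HasFDerivAt g (fderiv ℂ g 0) 0 := (hg.differentiableAt hU).hasFDerivAt
  have h0 : Y.proj (g 0) = 0 := by
    rw [← hfg 0 (mem_of_mem_nhds hU), map_zero]
    exact f.map_zero'
  refine ⟨fderiv ℂ g 0, fun v => ?_⟩
  have hinv : Tendsto (fun k : ℕ => ((k : ℝ) + 1)⁻¹) atTop (𝓝 0) :=
    (tendsto_inv_atTop_zero (𝕜 := ℝ)).comp
      (tendsto_atTop_add_const_right _ _ tendsto_natCast_atTop_atTop)
  have hd : Tendsto (fun k : ℕ => (((k : ℝ) + 1)⁻¹) • v) atTop (𝓝 (0 : X.V)) := by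
    simpa using hinv.smul_const v
  have hlim : Tendsto (fun k : ℕ => ((k : ℝ) + 1) •
      (g (0 + (((k : ℝ) + 1)⁻¹) • v) - g 0)) atTop (𝓝 (fderiv ℂ g 0 v)) := by
    have hR : HasFDerivWithinAt g ((fderiv ℂ g 0).restrictScalars ℝ) Set.univ 0 :=
      (hg0.restrictScalars ℝ).hasFDerivWithinAt
    refine hR.lim (l := atTop) hd (by simp) ?_
    refine tendsto_const_nhds.congr fun k => ?_
    rw [smul_smul, mul_inv_cancel₀ (by positivity), one_smul]
  have h1 : Tendsto (fun k : ℕ => Y.proj (((k : ℝ) + 1) •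
      (g (0 + (((k : ℝ) + 1)⁻¹) • v) - g 0))) atTop (𝓝 (Y.proj (fderiv ℂ g 0 v))) :=
    (Y.Λ.continuous_mkQ.tendsto _).comp hlim
  have h2 : ∀ᶠ k : ℕ in atTop, f (X.proj v) = Y.proj (((k : ℝ) + 1) •
      (g (0 + (((k : ℝ) + 1)⁻¹) • v) - g 0)) := by
    filter_upwards [hd.eventually hU] with k hk
    have e1 : v = (k + 1) • ((((k : ℝ) + 1)⁻¹) • v) := by
      rw [← Nat.cast_smul_eq_nsmul ℝ, smul_smul]
      push_cast
      rw [mul_inv_cancel₀ (by positivity), one_smul]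
    have e2 : ((k : ℝ) + 1) • (g (0 + (((k : ℝ) + 1)⁻¹) • v) - g 0)
        = (k + 1) • (g (0 + (((k : ℝ) + 1)⁻¹) • v) - g 0) := by
      rw [← Nat.cast_smul_eq_nsmul ℝ]
      push_cast
      rfl
    rw [e2, map_nsmul, map_sub, h0, sub_zero, zero_add, ← hfg _ hk]
    conv_lhs => rw [e1, map_nsmul]
    exact map_nsmul f.toAddMonoidHom _ _
  exact tendsto_nhds_unique (tendsto_const_nhds.congr' h2) h1

/-- The analytic representation of a morphism, i.e. its differential at the origin. -/
def lift (f : Hom X Y) : X.V →L[ℂ] Y.V := f.exists_lift.choose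

theorem proj_lift (f : Hom X Y) (v : X.V) : f (X.proj v) = Y.proj (f.lift v) :=
  f.exists_lift.choose_spec v

theorem lift_mem (f : Hom X Y) {v : X.V} (hv : v ∈ X.Λ) : f.lift v ∈ Y.Λ := by
  rw [← Y.proj_eq_zero_iff, ← f.proj_lift, X.proj_eq_zero_iff.2 hv]
  exact f.map_zero'

theorem lift_unique (f : Hom X Y) (F : X.V →L[ℂ] Y.V)
    (h : ∀ v, f (X.proj v) = Y.proj (F v)) : f.lift = F := by
  ext v
  by_contra hne
  set w := f.lift v - F v with hw
  have hw0 : w ≠ 0 := sub_ne_zero.2 hne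
  have hmem : ∀ t : ℝ, t • w ∈ Y.Λ := fun t => by
    have : Y.proj (f.lift (t • v)) = Y.proj (F (t • v)) := by rw [← proj_lift, h]
    have h2 := Y.proj_eq_proj_iff.1 this
    have e1 : f.lift (t • v) = t • f.lift v :=
      (f.lift.restrictScalars ℝ).map_smul t v
    have e2 : F (t • v) = t • F v := (F.restrictScalars ℝ).map_smul t v
    rwa [e1, e2, ← smul_sub] at h2
  let p : ℝ → Y.Λ := fun t => ⟨t • w, hmem t⟩
  have hp : Continuous p := by
    refine Continuous.subtype_mk ?_ _
    fun_prop
  have hpc : p 1 = p 0 := PreconnectedSpace.constant inferInstance hp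
  have : (1 : ℝ) • w = (0 : ℝ) • w := congrArg Subtype.val hpc
  simp at this
  exact hw0 this

/-- The rational representation `f_* : H₁(X, ℤ) → H₁(Y, ℤ)` of a morphism. -/
def homology (f : Hom X Y) : X.Λ →ₗ[ℤ] Y.Λ where
  toFun x := ⟨f.lift x, f.lift_mem x.2⟩
  map_add' x y := by ext; simp
  map_smul' k x := by ext; simp

/-- The morphism induced by a linear map that preserves the lattices. -/
def ofLinear (F : X.V →L[ℂ] Y.V) (h : ∀ v ∈ X.Λ, F v ∈ Y.Λ) : Hom X Y where
  toAddMonoidHom := (X.Λ.mapQ Y.Λ (F.toLinearMap.restrictScalars ℤ) h).toAddMonoidHom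
  holomorphic _ := ⟨Set.univ, univ_mem, F, F.differentiable.differentiableOn, fun _ _ => rfl⟩

theorem ofLinear_proj (F : X.V →L[ℂ] Y.V) (h : ∀ v ∈ X.Λ, F v ∈ Y.Λ) (v : X.V) :
    ofLinear F h (X.proj v) = Y.proj (F v) := rfl

theorem lift_ofLinear (F : X.V →L[ℂ] Y.V) (h : ∀ v ∈ X.Λ, F v ∈ Y.Λ) :
    (ofLinear F h).lift = F := lift_unique _ _ fun _ => rfl

protected def id (X : ComplexTorus.{u}) : Hom X X :=
  ofLinear (ContinuousLinearMap.id ℂ X.V) fun _ h => h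

theorem id_apply (x : X.Pts) : Hom.id X x = x := by
  obtain ⟨v, rfl⟩ := X.Λ.mkQ_surjective x
  rfl

theorem homology_id (x : X.Λ) : (Hom.id X).homology x = x := by
  ext
  change (Hom.id X).lift x = x
  rw [lift_unique (Hom.id X) (ContinuousLinearMap.id ℂ X.V) fun _ => rfl]
  rfl

/-- Composition of morphisms. -/
def comp (g : Hom Y Z) (f : Hom X Y) : Hom X Z where
  toAddMonoidHom := g.toAddMonoidHom.comp f.toAddMonoidHom
  holomorphic _ := ⟨Set.univ, univ_mem, g.lift.comp f.lift,
    (g.lift.comp f.lift).differentiable.differentiableOn, fun x _ => by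
      change g (f (X.proj x)) = _
      rw [f.proj_lift, g.proj_lift]
      rfl⟩

theorem comp_apply (g : Hom Y Z) (f : Hom X Y) (x : X.Pts) : g.comp f x = g (f x) := rfl

theorem homology_comp (g : Hom Y Z) (f : Hom X Y) (x : X.Λ) :
    (g.comp f).homology x = g.homology (f.homology x) := by
  ext
  change (g.comp f).lift x = g.lift (f.lift x)
  rw [lift_unique (g.comp f) (g.lift.comp f.lift) fun v => by
    rw [comp_apply, f.proj_lift, g.proj_lift]
    rfl]
  rfl

@[ext] theorem ext {f g : Hom X Y} (h : ∀ x, f x = g x) : f = g := by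
  cases f
  cases g
  congr
  exact AddMonoidHom.ext h

/-- An isogeny: a surjective morphism with finite kernel. -/
def IsIsogeny (f : Hom X Y) : Prop :=
  Function.Surjective f ∧ Finite f.toAddMonoidHom.ker

/-- An embedding: a homeomorphism onto a closed subset with injective differential. -/
def IsEmbedding (f : Hom X Y) : Prop :=
  IsClosedEmbedding f ∧ Function.Injective f.lift

end Hom

/-- An isomorphism of complex tori: a morphism with an inverse morphism. -/
structure Iso (X Y : ComplexTorus.{u}) where
  hom : Hom X Y
  inv : Hom Y X
  hom_inv : ∀ x, inv (hom x) = x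
  inv_hom : ∀ y, hom (inv y) = y

namespace Iso

variable {X Y Z : ComplexTorus.{u}}

protected def refl (X : ComplexTorus.{u}) : Iso X X :=
  ⟨Hom.id X, Hom.id X, fun x => by simp only [Hom.id_apply], fun x => by simp only [Hom.id_apply]⟩

protected def symm (e : Iso X Y) : Iso Y X := ⟨e.inv, e.hom, e.inv_hom, e.hom_inv⟩

protected def trans (e : Iso X Y) (e' : Iso Y Z) : Iso X Z :=
  ⟨e'.hom.comp e.hom, e.inv.comp e'.inv,
    fun x => by simp only [Hom.comp_apply, e'.hom_inv, e.hom_inv],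
    fun x => by simp only [Hom.comp_apply, e.inv_hom, e'.inv_hom]⟩

theorem homology_hom_inv (e : Iso X Y) (x : X.Λ) :
    e.inv.homology (e.hom.homology x) = x := by
  rw [← Hom.homology_comp, show e.inv.comp e.hom = Hom.id X from
    Hom.ext fun x => by rw [Hom.comp_apply, e.hom_inv, Hom.id_apply], Hom.homology_id]

theorem homology_inv_hom (e : Iso X Y) (y : Y.Λ) :
    e.hom.homology (e.inv.homology y) = y := e.symm.homology_hom_inv y

end Iso

/-! ### Products and quotients of complex tori -/

/-- The product lattice is the product of the lattices. -/
def prodLatticeEquiv {V W : Type u} [AddCommGroup V] [AddCommGroup W] (A : Submodule ℤ V)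
    (B : Submodule ℤ W) : (A × B) ≃ₗ[ℤ] A.prod B where
  toFun p := ⟨(p.1, p.2), p.1.2, p.2.2⟩
  invFun p := (⟨p.1.1, p.2.1⟩, ⟨p.1.2, p.2.2⟩)
  map_add' _ _ := rfl
  map_smul' _ _ := rfl
  left_inv _ := rfl
  right_inv _ := rfl

theorem discrete_prod (X X' : ComplexTorus.{u}) : DiscreteTopology (X.Λ.prod X'.Λ) := by
  have hf : Continuous (prodLatticeEquiv X.Λ X'.Λ).symm := by
    change Continuous fun p : X.Λ.prod X'.Λ =>
      ((⟨p.1.1, p.2.1⟩, ⟨p.1.2, p.2.2⟩) : X.Λ × X'.Λ)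
    fun_prop
  exact DiscreteTopology.of_continuous_injective hf (prodLatticeEquiv X.Λ X'.Λ).symm.injective

theorem isZLattice_prod (X X' : ComplexTorus.{u}) :
    @IsZLattice ℝ _ (X.V × X'.V) _ _ (X.Λ.prod X'.Λ) (discrete_prod X X') := by
  let _ := discrete_prod X X'
  refine ⟨eq_top_iff.2 ?_⟩
  rintro ⟨v, w⟩ -
  have h1 : Submodule.span ℝ (X.Λ : Set X.V) ≤
      (Submodule.span ℝ ((X.Λ.prod X'.Λ : Submodule ℤ (X.V × X'.V)) : Set (X.V × X'.V))).comap
        (LinearMap.inl ℝ X.V X'.V) :=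
    Submodule.span_le.2 fun x hx => Submodule.subset_span ⟨hx, X'.Λ.zero_mem⟩
  have h2 : Submodule.span ℝ (X'.Λ : Set X'.V) ≤
      (Submodule.span ℝ ((X.Λ.prod X'.Λ : Submodule ℤ (X.V × X'.V)) : Set (X.V × X'.V))).comap
        (LinearMap.inr ℝ X.V X'.V) :=
    Submodule.span_le.2 fun x hx => Submodule.subset_span ⟨X.Λ.zero_mem, hx⟩
  have h3 := h1 (by rw [IsZLattice.span_top]; trivial : v ∈ _)
  have h4 := h2 (by rw [IsZLattice.span_top]; trivial : w ∈ _)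
  have := Submodule.add_mem _ (Submodule.mem_comap.1 h3) (Submodule.mem_comap.1 h4)
  simpa using this

/-- The product of two complex tori. -/
protected def prod (X X' : ComplexTorus.{u}) : ComplexTorus.{u} :=
  letI := discrete_prod X X'
  letI := isZLattice_prod X X'
  { V := X.V × X'.V
    Λ := X.Λ.prod X'.Λ }

/-- The inclusion `X → X × X'`. -/
def inl (X X' : ComplexTorus.{u}) : Hom X (X.prod X') :=
  Hom.ofLinear (Y := X.prod X') (ContinuousLinearMap.inl ℂ X.V X'.V)
    fun _ h => ⟨h, X'.Λ.zero_mem⟩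

/-- The inclusion `X' → X × X'`. -/
def inr (X X' : ComplexTorus.{u}) : Hom X' (X.prod X') :=
  Hom.ofLinear (Y := X.prod X') (ContinuousLinearMap.inr ℂ X.V X'.V)
    fun _ h => ⟨X.Λ.zero_mem, h⟩

/-- The projection `X × X' → X`. -/
def fst (X X' : ComplexTorus.{u}) : Hom (X.prod X') X :=
  Hom.ofLinear (X := X.prod X') (ContinuousLinearMap.fst ℂ X.V X'.V) fun _ h => h.1

/-- The projection `X × X' → X'`. -/
def snd (X X' : ComplexTorus.{u}) : Hom (X.prod X') X' :=
  Hom.ofLinear (X := X.prod X') (ContinuousLinearMap.snd ℂ X.V X'.V) fun _ h => h.2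

/-- The point `(x, x')` of `X × X'`. -/
def pair {X X' : ComplexTorus.{u}} (x : X.Pts) (x' : X'.Pts) : (X.prod X').Pts :=
  inl X X' x + inr X X' x'

theorem fst_pair {X X' : ComplexTorus.{u}} (x : X.Pts) (x' : X'.Pts) :
    fst X X' (pair x x') = x := by
  obtain ⟨v, rfl⟩ := X.Λ.mkQ_surjective x
  obtain ⟨w, rfl⟩ := X'.Λ.mkQ_surjective x'
  change X.proj (v + 0) = X.proj v
  rw [add_zero]

theorem snd_pair {X X' : ComplexTorus.{u}} (x : X.Pts) (x' : X'.Pts) :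
    snd X X' (pair x x') = x' := by
  obtain ⟨v, rfl⟩ := X.Λ.mkQ_surjective x
  obtain ⟨w, rfl⟩ := X'.Λ.mkQ_surjective x'
  change X'.proj (0 + w) = X'.proj w
  rw [zero_add]

theorem pair_fst_snd {X X' : ComplexTorus.{u}} (z : (X.prod X').Pts) :
    pair (fst X X' z) (snd X X' z) = z := by
  obtain ⟨v, rfl⟩ := (X.prod X').Λ.mkQ_surjective z
  change (X.prod X').proj ((v.1 + 0, 0 + v.2) : X.V × X'.V) = (X.prod X').proj v
  rw [add_zero, zero_add]
  rfl

/-- The basis of `H₁(X × X', ℤ) = H₁(X, ℤ) × H₁(X', ℤ)` formed by bases of the two factors. -/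
def prodBasis {X X' : ComplexTorus.{u}} {ι ι' : Type} (b : Basis ι ℤ X.Λ)
    (b' : Basis ι' ℤ X'.Λ) : Basis (ι ⊕ ι') ℤ (X.prod X').Λ :=
  (b.prod b').map (prodLatticeEquiv X.Λ X'.Λ)

theorem discrete_comap (T : ComplexTorus.{u}) (F : Submodule ℤ T.Pts) [Finite F] :
    DiscreteTopology (F.comap T.proj) := by
  have hF : IsOpen ({0} : Set F) := isOpen_discrete _
  obtain ⟨U, hU, hU0⟩ := isOpen_induced_iff.1 hF
  have hL : IsOpen ({0} : Set T.Λ) := isOpen_discrete _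
  obtain ⟨W, hW, hW0⟩ := isOpen_induced_iff.1 hL
  refine discreteTopology_of_isOpen_singleton_zero (isOpen_induced_iff.2
    ⟨T.proj ⁻¹' U ∩ W, (hU.preimage T.Λ.continuous_mkQ).inter hW, ?_⟩)
  ext ⟨x, hx⟩
  constructor
  · rintro ⟨h1, h2⟩
    have h3 : (⟨T.proj x, hx⟩ : F) ∈ ({0} : Set F) := by
      rw [← hU0]
      exact h1
    have h4 : T.proj x = 0 := congrArg Subtype.val h3
    have h5 : (⟨x, T.proj_eq_zero_iff.1 h4⟩ : T.Λ) ∈ ({0} : Set T.Λ) := by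
      rw [← hW0]
      exact h2
    exact Subtype.ext (congrArg (fun z : T.Λ => (z : T.V)) h5)
  · intro h
    have hx0 : x = 0 := congrArg Subtype.val h
    subst hx0
    constructor
    · have : (0 : F) ∈ Subtype.val ⁻¹' U := by
        rw [hU0]
        rfl
      simpa using this
    · have : (0 : T.Λ) ∈ Subtype.val ⁻¹' W := by
        rw [hW0]
        rfl
      simpa using this

theorem isZLattice_comap (T : ComplexTorus.{u}) (F : Submodule ℤ T.Pts) [Finite F] :
    @IsZLattice ℝ _ T.V _ _ (F.comap T.proj) (discrete_comap T F) := by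
  let _ := discrete_comap T F
  refine ⟨eq_top_iff.2 ?_⟩
  rw [← IsZLattice.span_top (K := ℝ) (L := T.Λ)]
  refine Submodule.span_mono fun x hx => ?_
  change T.proj x ∈ F
  rw [T.proj_eq_zero_iff.2 hx]
  exact F.zero_mem

/-- The quotient of a complex torus by a finite subgroup: the same vector space modulo the
preimage of the subgroup. -/
def quotient (T : ComplexTorus.{u}) (F : Submodule ℤ T.Pts) [Finite F] : ComplexTorus.{u} :=
  letI := discrete_comap T F
  letI := isZLattice_comap T F
  { V := T.V
    Λ := F.comap T.proj }

/-- The quotient map `T → T / F`. -/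
def quotientMap (T : ComplexTorus.{u}) (F : Submodule ℤ T.Pts) [Finite F] :
    Hom T (T.quotient F) :=
  Hom.ofLinear (Y := T.quotient F) (ContinuousLinearMap.id ℂ T.V) fun v h => by
    change T.proj v ∈ F
    rw [T.proj_eq_zero_iff.2 h]
    exact F.zero_mem

theorem quotientMap_eq_zero_iff (T : ComplexTorus.{u}) (F : Submodule ℤ T.Pts) [Finite F]
    (x : T.Pts) : T.quotientMap F x = 0 ↔ x ∈ F := by
  obtain ⟨v, rfl⟩ := T.Λ.mkQ_surjective x
  exact (T.quotient F).proj_eq_zero_iff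

/-- The finite subgroup of a torus that an integer matrix `M`, viewed as `ℤ^ι → ℤ^κ`, cuts out by
means of a lattice basis `b`: the points with coordinates `x ∈ ℝ^ι` such that `M x ∈ ℤ^κ`.
When `M` is nonsingular it is `M⁻¹ ℤ^κ / ℤ^ι`, the image of the cokernel of `M`. -/
def kernelSubgroup (T : ComplexTorus.{u}) {ι κ : Type} [Fintype ι] (b : Basis ι ℤ T.Λ)
    (M : Matrix κ ι ℤ) : Submodule ℤ T.Pts where
  carrier := {p | ∃ (x : ι → ℝ) (y : κ → ℤ), M.map (Int.cast : ℤ → ℝ) *ᵥ x = (fun i => (y i : ℝ)) ∧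
    p = T.proj (∑ j, x j • (b j : T.V))}
  zero_mem' := ⟨0, 0, by ext i; simp, by simp⟩
  add_mem' := by
    rintro _ _ ⟨x, y, h, rfl⟩ ⟨x', y', h', rfl⟩
    refine ⟨x + x', y + y', ?_, ?_⟩
    · rw [Matrix.mulVec_add, h, h']
      ext i
      simp
    · rw [← map_add, ← Finset.sum_add_distrib]
      simp only [Pi.add_apply, add_smul]
  smul_mem' := by
    rintro k _ ⟨x, y, h, rfl⟩
    refine ⟨(k : ℝ) • x, k • y, ?_, ?_⟩
    · rw [Matrix.mulVec_smul, h]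
      ext i
      simp
    · rw [← map_smul, ← Int.cast_smul_eq_zsmul ℝ, Finset.smul_sum]
      simp only [Pi.smul_apply, smul_eq_mul, mul_smul]

end ComplexTorus

/-! ### Polarizations and symplectic bases -/

/-- A polarization of a complex torus `V / Λ`, given as an integral alternating form on
`Λ = H₁(V / Λ, ℤ)`: the imaginary part of a positive definite Hermitian form on `V`. -/
structure Polarization (X : ComplexTorus.{u}) where
  form : LinearMap.BilinForm ℤ X.Λ
  exists_hermitian : ∃ H : X.V →ₗ[ℂ] X.V →ₛₗ[starRingEnd ℂ] ℂ,
    (∀ v w, H w v = starRingEnd ℂ (H v w)) ∧ (∀ v, v ≠ 0 → 0 < (H v v).re) ∧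
      ∀ x y : X.Λ, (H x y).im = form x y

/-- A type of polarizations in dimension `n`: positive integers `d₁ ∣ d₂ ∣ ⋯ ∣ dₙ`. -/
structure PolarizationType (n : ℕ) where
  d : Fin n → ℕ
  pos : ∀ i, 0 < d i
  dvd : ∀ i j, i ≤ j → d i ∣ d j

/-- The matrix of an alternating form of type `D` in a symplectic basis. The index set
`Fin n ⊕ Fin n` stands for `1, …, n, n + 1, …, 2n`. -/
def PolarizationType.hat {n : ℕ} (D : PolarizationType n) :
    Matrix (Fin n ⊕ Fin n) (Fin n ⊕ Fin n) ℤ :=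
  Matrix.fromBlocks 0 (Matrix.diagonal fun i => (D.d i : ℤ))
    (-Matrix.diagonal fun i => (D.d i : ℤ)) 0

/-- A polarization of type `D` on a complex torus, with a symplectic basis for it. -/
structure SymplecticPolarization (X : ComplexTorus.{u}) {n : ℕ} (D : PolarizationType n) where
  pol : Polarization X
  basis : Basis (Fin n ⊕ Fin n) ℤ X.Λ
  symplectic : LinearMap.BilinForm.toMatrix basis pol.form = D.hat

/-- An abelian variety with a symplectic basis for a polarization of type `D`. -/
structure BasedAbelianVariety {n : ℕ} (D : PolarizationType n) where
  torus : ComplexTorus.{u}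
  str : SymplecticPolarization torus D

namespace BasedAbelianVariety

variable {n : ℕ} {D : PolarizationType n}

/-- The alternating form on `H₁`. -/
abbrev form (X : BasedAbelianVariety.{u} D) : LinearMap.BilinForm ℤ X.torus.Λ := X.str.pol.form

/-- The symplectic basis. -/
abbrev basis (X : BasedAbelianVariety.{u} D) : Basis (Fin n ⊕ Fin n) ℤ X.torus.Λ := X.str.basis

/-- The isomorphism `e` preserves the polarizations and the symplectic bases. -/
def Preserves {X Y : BasedAbelianVariety.{u} D} (e : ComplexTorus.Iso X.torus Y.torus) : Prop :=
  (∀ x y, Y.form (e.hom.homology x) (e.hom.homology y) = X.form x y) ∧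
    ∀ i, e.hom.homology (X.basis i) = Y.basis i

theorem preserves_refl (X : BasedAbelianVariety.{u} D) :
    Preserves (X := X) (Y := X) (ComplexTorus.Iso.refl X.torus) := by
  constructor
  · intro x y
    simp only [ComplexTorus.Iso.refl, ComplexTorus.Hom.homology_id]
  · intro i
    simp only [ComplexTorus.Iso.refl, ComplexTorus.Hom.homology_id]

theorem Preserves.symm {X Y : BasedAbelianVariety.{u} D}
    {e : ComplexTorus.Iso X.torus Y.torus} (h : Preserves e) :
    Preserves (X := Y) (Y := X) e.symm := by
  constructor
  · intro x y
    rw [← h.1]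
    change Y.form (e.hom.homology (e.inv.homology x)) (e.hom.homology (e.inv.homology y)) = _
    rw [e.homology_inv_hom, e.homology_inv_hom]
  · intro i
    rw [← h.2]
    exact e.homology_hom_inv _

theorem Preserves.trans {X Y Z : BasedAbelianVariety.{u} D}
    {e : ComplexTorus.Iso X.torus Y.torus} {e' : ComplexTorus.Iso Y.torus Z.torus}
    (h : Preserves e) (h' : Preserves e') : Preserves (X := X) (Y := Z) (e.trans e') := by
  constructor
  · intro x y
    simp only [ComplexTorus.Iso.trans, ComplexTorus.Hom.homology_comp, h'.1, h.1]
  · intro i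
    simp only [ComplexTorus.Iso.trans, ComplexTorus.Hom.homology_comp, h'.2, h.2]

/-- Isomorphism of abelian varieties with symplectic bases. -/
instance setoid (D : PolarizationType n) : Setoid (BasedAbelianVariety.{u} D) where
  r X Y := ∃ e : ComplexTorus.Iso X.torus Y.torus, Preserves e
  iseqv :=
    { refl X := ⟨_, preserves_refl X⟩
      symm := fun ⟨_, h⟩ => ⟨_, h.symm⟩
      trans := fun ⟨_, h⟩ ⟨_, h'⟩ => ⟨_, h.trans h'⟩ }

end BasedAbelianVariety

/-- The collection `A'_D` of isomorphism classes of abelian varieties with a symplectic basis for a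
polarization of type `D`. -/
def BasedAbelianVarietyClass {n : ℕ} (D : PolarizationType n) : Type (u + 1) :=
  Quotient (BasedAbelianVariety.setoid.{u} D)

/-- The isomorphism class of an abelian variety with symplectic basis. -/
def BasedAbelianVariety.toClass {n : ℕ} {D : PolarizationType n} (X : BasedAbelianVariety.{u} D) :
    BasedAbelianVarietyClass.{u} D := Quotient.mk _ X

/-! ### Embeddings with their complementary embeddings -/

/-- The morphism `s : X × X' → Y` is an isogeny which is a sum of complementary embeddings, the
polarizations of `X` and `X'` are those induced from `Y`, and `M` is the matrix of `s_*` with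
respect to the symplectic bases. -/
structure IsEmbeddingOfType {n n' m : ℕ} {D : PolarizationType n} {D' : PolarizationType n'}
    {E : PolarizationType m}
    (M : Matrix (Fin m ⊕ Fin m) ((Fin n ⊕ Fin n) ⊕ (Fin n' ⊕ Fin n')) ℤ)
    (X : BasedAbelianVariety.{u} D) (X' : BasedAbelianVariety.{u} D')
    (Y : BasedAbelianVariety.{u} E)
    (s : ComplexTorus.Hom (X.torus.prod X'.torus) Y.torus) : Prop where
  isogeny : s.IsIsogeny
  embedding_left : (s.comp (ComplexTorus.inl X.torus X'.torus)).IsEmbedding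
  embedding_right : (s.comp (ComplexTorus.inr X.torus X'.torus)).IsEmbedding
  /-- `L_X = e^* L_Y` for the restriction `e : X → Y` of `s`. -/
  induced_left : ∀ x y,
    Y.form ((s.comp (ComplexTorus.inl X.torus X'.torus)).homology x)
      ((s.comp (ComplexTorus.inl X.torus X'.torus)).homology y) = X.form x y
  /-- `L_X' = e'^* L_Y` for the restriction `e' : X' → Y` of `s`. -/
  induced_right : ∀ x y,
    Y.form ((s.comp (ComplexTorus.inr X.torus X'.torus)).homology x)
      ((s.comp (ComplexTorus.inr X.torus X'.torus)).homology y) = X'.form x y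
  /-- `s^* L_Y = p^* L_X ⊗ p'^* L_X'`. -/
  complementary : ∀ z w,
    Y.form (s.homology z) (s.homology w) =
      X.form ((ComplexTorus.fst X.torus X'.torus).homology z)
        ((ComplexTorus.fst X.torus X'.torus).homology w) +
      X'.form ((ComplexTorus.snd X.torus X'.torus).homology z)
        ((ComplexTorus.snd X.torus X'.torus).homology w)
  matrix : LinearMap.toMatrix (ComplexTorus.prodBasis X.basis X'.basis) Y.basis s.homology = M

/-- An embedding of type `(D, D', E), M` with symplectic bases, given by the isogeny
`s : X × X' → Y` which is the sum of it and of the complementary embedding. -/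
structure EmbeddingDatum {n n' m : ℕ} (D : PolarizationType n) (D' : PolarizationType n')
    (E : PolarizationType m)
    (M : Matrix (Fin m ⊕ Fin m) ((Fin n ⊕ Fin n) ⊕ (Fin n' ⊕ Fin n')) ℤ) where
  X : BasedAbelianVariety.{u} D
  X' : BasedAbelianVariety.{u} D'
  Y : BasedAbelianVariety.{u} E
  s : ComplexTorus.Hom (X.torus.prod X'.torus) Y.torus
  ofType : IsEmbeddingOfType M X X' Y s

section

variable {n n' m : ℕ} (D : PolarizationType n) (D' : PolarizationType n')
  (E : PolarizationType m) (M : Matrix (Fin m ⊕ Fin m) ((Fin n ⊕ Fin n) ⊕ (Fin n' ⊕ Fin n')) ℤ)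

/-- Isomorphism `s ≅ t`: isomorphisms `u`, `u'`, `v` of the three pairs of varieties, preserving
polarizations and bases, with `t ∘ (u × u') = v ∘ s`. -/
instance EmbeddingDatum.setoid : Setoid (EmbeddingDatum.{u} D D' E M) where
  r a b := ∃ (u : ComplexTorus.Iso a.X.torus b.X.torus) (u' : ComplexTorus.Iso a.X'.torus b.X'.torus)
    (v : ComplexTorus.Iso a.Y.torus b.Y.torus),
      BasedAbelianVariety.Preserves u ∧ BasedAbelianVariety.Preserves u' ∧
      BasedAbelianVariety.Preserves v ∧
      ∀ x x', b.s (ComplexTorus.pair (u.hom x) (u'.hom x')) =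
        v.hom (a.s (ComplexTorus.pair x x'))
  iseqv :=
    { refl a := ⟨_, _, _, a.X.preserves_refl, a.X'.preserves_refl, a.Y.preserves_refl,
        fun x x' => by simp only [ComplexTorus.Iso.refl, ComplexTorus.Hom.id_apply]⟩
      symm := fun {a b} ⟨u, u', v, h, h', k, c⟩ => ⟨_, _, _, h.symm, h'.symm, k.symm,
        fun x x' => by
          have := c (u.inv x) (u'.inv x')
          rw [u.inv_hom, u'.inv_hom] at this
          change _ = v.inv _
          rw [this, v.hom_inv]
          rfl⟩
      trans := fun ⟨u, u', v, h, h', k, c⟩ ⟨u₁, u₁', v₁, h₁, h₁', k₁, c₁⟩ =>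
        ⟨_, _, _, h.trans h₁, h'.trans h₁', k.trans k₁, fun x x' => by
          simp only [ComplexTorus.Iso.trans, ComplexTorus.Hom.comp_apply, c₁, c]⟩ }

/-- The collection `E'_δ(M)`, for `δ = (D, D', E)`, of isomorphism classes of embeddings of type
`δ, M` with symplectic bases. -/
def EmbeddingClass : Type (u + 1) := Quotient (EmbeddingDatum.setoid.{u} D D' E M)

/-- The datum `δ, M` is a type of embeddings: it is the type of some embedding. -/
def IsTypeOfEmbeddings : Prop := Nonempty (EmbeddingClass.{u} D D' E M)

end

/-- The isomorphism class of an embedding with symplectic bases. -/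
def EmbeddingDatum.toClass {n n' m : ℕ} {D : PolarizationType n} {D' : PolarizationType n'}
    {E : PolarizationType m}
    {M : Matrix (Fin m ⊕ Fin m) ((Fin n ⊕ Fin n) ⊕ (Fin n' ⊕ Fin n')) ℤ}
    (a : EmbeddingDatum.{u} D D' E M) : EmbeddingClass.{u} D D' E M := Quotient.mk _ a

/-- The subgroup `F ⊂ X × X'` determined by `M` and the symplectic bases. -/
def embeddingKernel {n n' m : ℕ} {D : PolarizationType n} {D' : PolarizationType n'}
    (M : Matrix (Fin m ⊕ Fin m) ((Fin n ⊕ Fin n) ⊕ (Fin n' ⊕ Fin n')) ℤ)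
    (X : BasedAbelianVariety.{u} D) (X' : BasedAbelianVariety.{u} D') :
    Submodule ℤ (X.torus.prod X'.torus).Pts :=
  (X.torus.prod X'.torus).kernelSubgroup (ComplexTorus.prodBasis X.basis X'.basis) M

end

/-!
The two symplectic bases together form a basis of `H₁(X × X', ℤ)`, which identifies the universal
cover of `X × X'` with a real coordinate space. Write `D̂`, `D̂'`, `Ê` for the matrices of forms of types
`D`, `D'`, `E` in symplectic bases.

An embedding of type `M` forces three conditions on `M` alone (`IsEmbeddingMatrix`). The polarization
of `Y` pulls back to the sum of those of `X` and `X'`, so that `Mᵀ Ê M = diag(D̂, D̂')`, and since `X`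
and `X'` embed into `Y`, the restrictions of `M` to the two summands are primitive: only integral
vectors have an integral image (`ComplexTorus.Hom.injective_iff`). As `D̂` and `D̂'` are nondegenerate,
the first condition makes the square matrix `M` invertible over `ℝ`
(`IsEmbeddingMatrix.exists_inverse`).

Conversely, let `X` and `X'` be given. The points of the universal cover whose coordinates are mapped
to integral vectors by `M` form a lattice; its quotient by the lattice of integral vectors is the
subgroup `F`, isomorphic to the cokernel of `M` and therefore finite. The columns of `M⁻¹` are a
basis of the lattice of `Y = (X × X') / F`, in which the quotient map has the matrix `M`. The
Hermitian form on `X × X'` is also a Hermitian form for `Y`, and in that basis its imaginary part has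
the matrix `M⁻ᵀ diag(D̂, D̂') M⁻¹ = Ê`, which is integral of type `E`
(`ComplexTorus.exists_polarization_quotient`). Primitivity makes `X → Y` and `X' → Y` injective, hence
closed embeddings by compactness. This gives surjectivity
(`IsEmbeddingMatrix.exists_isEmbeddingOfType`).

For injectivity, isomorphisms `u` and `u'` of the factors of `s` and `t` induce the complex linear map
`t ∘ (u × u') ∘ s⁻¹` of universal covers. Both isogenies have the matrix `M`, so this map carries the
symplectic basis of `Y` to that of `Y₁`, and therefore induces an isomorphism `Y → Y₁`
(`EmbeddingDatum.toClass_eq_of_factors`).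
-/

noncomputable section

namespace ComplexTorus

/-! ### Real coordinates on the universal cover -/

section Coordinates

variable {ι κ : Type}

/-- The basis of the real vector space `V` formed by a basis of the lattice `Λ`. -/
def realBasis (T : ComplexTorus.{u}) (b : Basis ι ℤ T.Λ) : Basis ι ℝ T.V :=
  b.ofZLatticeBasis ℝ T.Λ

theorem realBasis_apply (T : ComplexTorus.{u}) (b : Basis ι ℤ T.Λ) (i : ι) :
    T.realBasis b i = b i :=
  b.ofZLatticeBasis_apply ℝ T.Λ i

variable [Fintype ι] [Fintype κ]

/-- The vector of `V` with real coordinates `x` with respect to a basis of the lattice. -/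
def ofCoords (T : ComplexTorus.{u}) (b : Basis ι ℤ T.Λ) : (ι → ℝ) ≃ₗ[ℝ] T.V :=
  (T.realBasis b).equivFun.symm

theorem ofCoords_apply (T : ComplexTorus.{u}) (b : Basis ι ℤ T.Λ) (x : ι → ℝ) :
    T.ofCoords b x = ∑ j, x j • (b j : T.V) := by
  simp only [ofCoords, Basis.equivFun_symm_apply, realBasis_apply]

theorem ofCoords_single [DecidableEq ι] (T : ComplexTorus.{u}) (b : Basis ι ℤ T.Λ) (i : ι) :
    T.ofCoords b (Pi.single i 1) = b i := by
  simp [ofCoords, realBasis_apply]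

theorem ofCoords_intCast (T : ComplexTorus.{u}) (b : Basis ι ℤ T.Λ) (m : ι → ℤ) :
    T.ofCoords b (fun i => (m i : ℝ)) = (b.equivFun.symm m : T.Λ) := by
  rw [ofCoords_apply, Basis.equivFun_symm_apply, AddSubmonoidClass.coe_finsetSum]
  exact Finset.sum_congr rfl fun j _ => by simp [Int.cast_smul_eq_zsmul]

theorem ofCoords_mem_iff (T : ComplexTorus.{u}) (b : Basis ι ℤ T.Λ) (x : ι → ℝ) :
    T.ofCoords b x ∈ T.Λ ↔ ∃ m : ι → ℤ, x = fun i => (m i : ℝ) := by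
  constructor
  · intro h
    refine ⟨b.equivFun ⟨_, h⟩, (T.ofCoords b).injective ?_⟩
    rw [ofCoords_intCast, LinearEquiv.symm_apply_apply]
  · rintro ⟨m, rfl⟩
    rw [ofCoords_intCast]
    exact Subtype.coe_prop _

/-- A complex torus is compact: it is the image of the unit cube. -/
theorem compactSpace_pts (T : ComplexTorus.{u}) (b : Basis ι ℤ T.Λ) : CompactSpace T.Pts := by
  have hc : Continuous fun x : ι → ℝ => T.proj (T.ofCoords b x) :=
    T.Λ.continuous_mkQ.comp (T.ofCoords b).toLinearMap.continuous_of_finiteDimensional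
  have hK : IsCompact (Set.pi Set.univ fun _ : ι => Set.Icc (0 : ℝ) 1) :=
    isCompact_univ_pi fun _ => isCompact_Icc
  refine ⟨?_⟩
  convert hK.image hc
  refine (Set.eq_univ_of_forall fun p => ?_).symm
  obtain ⟨v, rfl⟩ := T.Λ.mkQ_surjective p
  obtain ⟨x, rfl⟩ := (T.ofCoords b).surjective v
  refine ⟨fun i => Int.fract (x i), fun i _ => ⟨Int.fract_nonneg _, (Int.fract_lt_one _).le⟩, ?_⟩
  refine T.proj_eq_proj_iff.2 ?_
  rw [← map_sub, ofCoords_mem_iff]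
  refine ⟨fun i => -⌊x i⌋, ?_⟩
  ext i
  simp only [Pi.sub_apply, Int.cast_neg]
  linarith [Int.floor_add_fract (x i)]

variable {A B : ComplexTorus.{u}}

/-- The matrix of the rational representation of a morphism also describes its differential in real
coordinates. -/
theorem Hom.lift_ofCoords [DecidableEq ι] (f : Hom A B) (a : Basis ι ℤ A.Λ) (b : Basis κ ℤ B.Λ)
    (x : ι → ℝ) :
    f.lift (A.ofCoords a x) = B.ofCoords b
      ((LinearMap.toMatrix a b f.homology).map (Int.cast : ℤ → ℝ) *ᵥ x) := by
  set P := LinearMap.toMatrix a b f.homology with hP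
  have hL : (f.lift.toLinearMap.restrictScalars ℝ) ∘ₗ (A.ofCoords a).toLinearMap =
      (B.ofCoords b).toLinearMap ∘ₗ (P.map (Int.cast : ℤ → ℝ)).mulVecLin := by
    refine (Pi.basisFun ℝ ι).ext fun i => ?_
    simp only [Pi.basisFun_apply, LinearMap.comp_apply, LinearEquiv.coe_coe, ofCoords_single,
      Matrix.mulVecLin_apply, Matrix.mulVec_single_one]
    have h1 : B.ofCoords b ((P.map (Int.cast : ℤ → ℝ)).col i) =
        (b.equivFun.symm (P.col i) : B.Λ) := ofCoords_intCast B b (P.col i)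
    rw [h1]
    have h2 : b.equivFun.symm (P.col i) = f.homology (a i) := by
      rw [LinearEquiv.symm_apply_eq]
      ext k
      simp [hP, LinearMap.toMatrix_apply]
    rw [h2]
    rfl
  exact LinearMap.congr_fun hL x

/-- A morphism is injective if and only if its matrix is primitive, i.e. if only integral vectors
are mapped to integral vectors. -/
theorem Hom.injective_iff [DecidableEq ι] (f : Hom A B) (a : Basis ι ℤ A.Λ) (b : Basis κ ℤ B.Λ) :
    Function.Injective f ↔ ∀ (x : ι → ℝ) (y : κ → ℤ),
      (LinearMap.toMatrix a b f.homology).map (Int.cast : ℤ → ℝ) *ᵥ x = (fun k => (y k : ℝ)) →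
        ∃ m : ι → ℤ, x = fun i => (m i : ℝ) := by
  constructor
  · intro hf x y hxy
    rw [← ofCoords_mem_iff A a, ← A.proj_eq_zero_iff]
    apply hf
    rw [f.proj_lift, f.lift_ofCoords a b, hxy, B.proj_eq_zero_iff.2 ((ofCoords_mem_iff _ _ _).2
      ⟨y, rfl⟩)]
    exact f.map_zero'.symm
  · intro h
    refine (injective_iff_map_eq_zero f.toAddMonoidHom).2 fun p hp => ?_
    obtain ⟨v, rfl⟩ := A.Λ.mkQ_surjective p
    obtain ⟨x, rfl⟩ := (A.ofCoords a).surjective v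
    have h1 : B.proj (f.lift (A.ofCoords a x)) = 0 := (f.proj_lift _).symm.trans hp
    rw [B.proj_eq_zero_iff, f.lift_ofCoords a b, ofCoords_mem_iff] at h1
    obtain ⟨y, hy⟩ := h1
    exact A.proj_eq_zero_iff.2 ((ofCoords_mem_iff _ _ _).2 (h x y hy))

/-- If the matrix of a morphism is invertible over `ℝ`, then its differential is bijective. -/
theorem Hom.bijective_lift [DecidableEq ι] [DecidableEq κ] (f : Hom A B) (a : Basis ι ℤ A.Λ)
    (b : Basis κ ℤ B.Λ) (N : Matrix ι κ ℝ)
    (h₁ : (LinearMap.toMatrix a b f.homology).map (Int.cast : ℤ → ℝ) * N = 1)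
    (h₂ : N * (LinearMap.toMatrix a b f.homology).map (Int.cast : ℤ → ℝ) = 1) :
    Function.Bijective f.lift := by
  constructor
  · refine (injective_iff_map_eq_zero f.lift).2 fun v hv => ?_
    obtain ⟨x, rfl⟩ := (A.ofCoords a).surjective v
    rw [f.lift_ofCoords a b, LinearEquiv.map_eq_zero_iff] at hv
    have := congrArg (N *ᵥ ·) hv
    simp only [Matrix.mulVec_mulVec, h₂, Matrix.one_mulVec, Matrix.mulVec_zero] at this
    rw [this, map_zero]
  · intro w
    obtain ⟨y, rfl⟩ := (B.ofCoords b).surjective w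
    refine ⟨A.ofCoords a (N *ᵥ y), ?_⟩
    rw [f.lift_ofCoords a b, Matrix.mulVec_mulVec, h₁, Matrix.one_mulVec]

theorem map_ofCoords (F : A.V →L[ℂ] B.V) (a : Basis ι ℤ A.Λ) (b : Basis ι ℤ B.Λ)
    (h : ∀ i, F (a i) = b i) (x : ι → ℝ) : F (A.ofCoords a x) = B.ofCoords b x := by
  classical
  have hL : (F.toLinearMap.restrictScalars ℝ) ∘ₗ (A.ofCoords a).toLinearMap =
      (B.ofCoords b).toLinearMap := by
    refine (Pi.basisFun ℝ ι).ext fun i => ?_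
    simp only [Pi.basisFun_apply, LinearMap.comp_apply, LinearEquiv.coe_coe, ofCoords_single]
    exact h i
  exact LinearMap.congr_fun hL x

/-- A complex linear map that sends a basis of the one lattice to a basis of the other one induces
an isomorphism of tori. -/
theorem exists_iso_of_basis (F : A.V →L[ℂ] B.V) (a : Basis ι ℤ A.Λ) (b : Basis ι ℤ B.Λ)
    (h : ∀ i, F (a i) = b i) :
    ∃ e : Iso A B, (∀ v, e.hom (A.proj v) = B.proj (F v)) ∧ ∀ i, e.hom.homology (a i) = b i := by
  have hF := map_ofCoords F a b h
  have hbij : Function.Bijective F := by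
    have : (F : A.V → B.V) = (B.ofCoords b) ∘ (A.ofCoords a).symm := by
      ext v
      obtain ⟨x, rfl⟩ := (A.ofCoords a).surjective v
      simp [hF]
    rw [this]
    exact (B.ofCoords b).bijective.comp (A.ofCoords a).symm.bijective
  -- A complex linear bijection has a complex linear, automatically continuous, inverse.
  let G : A.V ≃ₗ[ℂ] B.V := LinearEquiv.ofBijective F.toLinearMap hbij
  have hFΛ : ∀ v ∈ A.Λ, F v ∈ B.Λ := by
    intro v hv
    obtain ⟨x, rfl⟩ := (A.ofCoords a).surjective v
    rw [hF, ofCoords_mem_iff]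
    exact (ofCoords_mem_iff _ _ _).1 hv
  have hGΛ : ∀ w ∈ B.Λ, G.symm.toLinearMap.toContinuousLinearMap w ∈ A.Λ := by
    intro w hw
    obtain ⟨x, rfl⟩ := (B.ofCoords b).surjective w
    have : G.symm (B.ofCoords b x) = A.ofCoords a x := by
      rw [LinearEquiv.symm_apply_eq]
      exact (hF x).symm
    change G.symm (B.ofCoords b x) ∈ A.Λ
    rw [this, ofCoords_mem_iff]
    exact (ofCoords_mem_iff _ _ _).1 hw
  refine ⟨⟨Hom.ofLinear F hFΛ, Hom.ofLinear _ hGΛ, ?_, ?_⟩, fun v => rfl, fun i => ?_⟩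
  · intro p
    obtain ⟨v, rfl⟩ := A.Λ.mkQ_surjective p
    exact congrArg A.proj (G.symm_apply_apply v)
  · intro p
    obtain ⟨v, rfl⟩ := B.Λ.mkQ_surjective p
    exact congrArg B.proj (G.apply_symm_apply v)
  · ext
    change (Hom.ofLinear F hFΛ).lift (a i) = _
    rw [Hom.lift_ofLinear, h]

end Coordinates

end ComplexTorus

namespace ComplexTorus

/-! ### The finite subgroup cut out by an integer matrix -/

theorem map_intCast_mulVec {ι κ : Type} [Fintype ι] (M : Matrix κ ι ℤ) (m : ι → ℤ) :
    M.map (Int.cast : ℤ → ℝ) *ᵥ (fun i => (m i : ℝ)) = fun k => ((M *ᵥ m) k : ℝ) := by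
  ext k
  simp [Matrix.mulVec, dotProduct]

theorem map_intCast_mul {ι κ l : Type} [Fintype ι] (A : Matrix κ ι ℤ) (B : Matrix ι l ℤ) :
    (A * B).map (Int.cast : ℤ → ℝ) = A.map (Int.cast : ℤ → ℝ) * B.map (Int.cast : ℤ → ℝ) :=
  Matrix.map_mul (f := Int.castRingHom ℝ)

section Kernel

variable {ι κ : Type} [Fintype ι] [Fintype κ] (T : ComplexTorus.{u}) (b : Basis ι ℤ T.Λ)
  (M : Matrix κ ι ℤ) (N : Matrix ι κ ℝ)

/-- The vector of `V` with real coordinates `N y`, for an integral vector `y`. If `N` is the inverse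
of `M`, this is the vector whose coordinates are mapped to `y` by `M`. -/
def preimageVec : (κ → ℤ) →ₗ[ℤ] T.V :=
  ((T.ofCoords b).toLinearMap ∘ₗ N.mulVecLin).restrictScalars ℤ ∘ₗ
    (Algebra.linearMap ℤ ℝ).compLeft κ

theorem preimageVec_apply (y : κ → ℤ) :
    T.preimageVec b N y = T.ofCoords b (N *ᵥ fun k => (y k : ℝ)) := rfl

variable {M N}

theorem preimageVec_eq [DecidableEq ι] (hNM : N * M.map (Int.cast : ℤ → ℝ) = 1) {x : ι → ℝ} {y : κ → ℤ}
    (h : M.map (Int.cast : ℤ → ℝ) *ᵥ x = fun k => (y k : ℝ)) :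
    T.preimageVec b N y = T.ofCoords b x := by
  rw [preimageVec_apply, ← h, Matrix.mulVec_mulVec, hNM, Matrix.one_mulVec]

theorem proj_mem_kernelSubgroup_iff [DecidableEq ι] [DecidableEq κ]
    (hMN : M.map (Int.cast : ℤ → ℝ) * N = 1)
    (hNM : N * M.map (Int.cast : ℤ → ℝ) = 1) (v : T.V) :
    T.proj v ∈ T.kernelSubgroup b M ↔ ∃ y, T.preimageVec b N y = v := by
  constructor
  · rintro ⟨x, y, hxy, hv⟩
    obtain ⟨z, rfl⟩ := (T.ofCoords b).surjective v
    rw [← ofCoords_apply, proj_eq_proj_iff, ← map_sub, ofCoords_mem_iff] at hv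
    obtain ⟨m, hm⟩ := hv
    refine ⟨y + M *ᵥ m, T.preimageVec_eq b hNM ?_⟩
    rw [show z = x + fun i => (m i : ℝ) by rw [← hm]; abel, Matrix.mulVec_add, hxy,
      map_intCast_mulVec]
    ext k
    simp
  · rintro ⟨y, rfl⟩
    refine ⟨N *ᵥ fun k => (y k : ℝ), y, ?_, ?_⟩
    · rw [Matrix.mulVec_mulVec, hMN, Matrix.one_mulVec]
    · rw [← ofCoords_apply, preimageVec_apply]

theorem preimageVec_injective [DecidableEq κ] (hMN : M.map (Int.cast : ℤ → ℝ) * N = 1) :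
    Function.Injective (T.preimageVec b N) := by
  intro y z h
  have h1 := congrArg (M.map (Int.cast : ℤ → ℝ) *ᵥ ·) ((T.ofCoords b).injective h)
  simp only [Matrix.mulVecLin_apply, Matrix.mulVec_mulVec, hMN, Matrix.one_mulVec] at h1
  ext k
  exact Int.cast_injective (α := ℝ) (congrFun h1 k)

theorem preimageVec_mem_iff [DecidableEq ι] [DecidableEq κ]
    (hMN : M.map (Int.cast : ℤ → ℝ) * N = 1)
    (hNM : N * M.map (Int.cast : ℤ → ℝ) = 1) (y : κ → ℤ) :
    T.preimageVec b N y ∈ T.Λ ↔ y ∈ LinearMap.range M.mulVecLin := by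
  rw [preimageVec_apply, ofCoords_mem_iff]
  constructor
  · rintro ⟨m, hm⟩
    refine ⟨m, ?_⟩
    have := congrArg (M.map (Int.cast : ℤ → ℝ) *ᵥ ·) hm
    simp only [Matrix.mulVec_mulVec, hMN, Matrix.one_mulVec, map_intCast_mulVec] at this
    ext k
    exact_mod_cast (congrFun this k).symm
  · rintro ⟨m, rfl⟩
    refine ⟨m, ?_⟩
    rw [Matrix.mulVecLin_apply, ← map_intCast_mulVec, Matrix.mulVec_mulVec, hNM, Matrix.one_mulVec]

/-- The cokernel of `M` is isomorphic to the subgroup that `M` cuts out: the point with real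
coordinates `x` corresponds to the class of `M x`. -/
theorem exists_coker_equiv_kernelSubgroup [DecidableEq ι] [DecidableEq κ]
    (hMN : M.map (Int.cast : ℤ → ℝ) * N = 1) (hNM : N * M.map (Int.cast : ℤ → ℝ) = 1) :
    ∃ φ : ((κ → ℤ) ⧸ LinearMap.range M.mulVecLin) ≃ₗ[ℤ] T.kernelSubgroup b M,
      ∀ (x : ι → ℝ) (y : κ → ℤ), M.map (Int.cast : ℤ → ℝ) *ᵥ x = (fun k => (y k : ℝ)) →
        (φ (Submodule.Quotient.mk y) : T.Pts) = T.proj (∑ j, x j • (b j : T.V)) := by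
  let ψ : (κ → ℤ) →ₗ[ℤ] T.kernelSubgroup b M :=
    (T.proj ∘ₗ T.preimageVec b N).codRestrict _ fun y =>
      (T.proj_mem_kernelSubgroup_iff b hMN hNM _).2 ⟨y, rfl⟩
  have hψ : Function.Surjective ψ := by
    rintro ⟨p, hp⟩
    obtain ⟨v, rfl⟩ := T.Λ.mkQ_surjective p
    obtain ⟨y, rfl⟩ := (T.proj_mem_kernelSubgroup_iff b hMN hNM _).1 hp
    exact ⟨y, rfl⟩
  have hker : LinearMap.range M.mulVecLin = LinearMap.ker ψ := by
    ext y
    rw [← T.preimageVec_mem_iff b hMN hNM, LinearMap.mem_ker, ← T.proj_eq_zero_iff]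
    exact Submodule.coe_eq_zero (x := ψ y)
  refine ⟨(Submodule.quotEquivOfEq _ _ hker).trans (ψ.quotKerEquivOfSurjective hψ), ?_⟩
  intro x y hxy
  rw [← ofCoords_apply, ← T.preimageVec_eq b hNM hxy]
  rfl

/-- The subgroup cut out by `M` is finite, since the cokernel of a square matrix with nonzero
determinant is. -/
theorem finite_kernelSubgroup [DecidableEq ι] [DecidableEq κ]
    (hMN : M.map (Int.cast : ℤ → ℝ) * N = 1) (hNM : N * M.map (Int.cast : ℤ → ℝ) = 1)
    (hcard : Fintype.card ι = Fintype.card κ) : Finite (T.kernelSubgroup b M) := by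
  obtain ⟨φ, -⟩ := T.exists_coker_equiv_kernelSubgroup b hMN hNM
  have hinj : Function.Injective M.mulVecLin := by
    intro m m' h
    have h1 := congrArg (fun y : κ → ℤ => N *ᵥ fun k => (y k : ℝ)) h
    simp only [Matrix.mulVecLin_apply, ← map_intCast_mulVec, Matrix.mulVec_mulVec, hNM,
      Matrix.one_mulVec] at h1
    ext i
    exact_mod_cast congrFun h1 i
  have : Finite ((κ → ℤ) ⧸ LinearMap.range M.mulVecLin) := by
    refine Submodule.finiteQuotientOfFreeOfRankEq _ ?_
    rw [LinearMap.finrank_range_of_inj hinj, Module.finrank_fintype_fun_eq_card,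
      Module.finrank_fintype_fun_eq_card, hcard]
  exact Finite.of_equiv _ φ.toEquiv

/-- The lattice of the quotient by the subgroup cut out by `M` is `M⁻¹ ℤ^κ` in real coordinates. -/
def quotientLatticeEquiv [DecidableEq ι] [DecidableEq κ] [Finite (T.kernelSubgroup b M)]
    (hMN : M.map (Int.cast : ℤ → ℝ) * N = 1) (hNM : N * M.map (Int.cast : ℤ → ℝ) = 1) :
    (κ → ℤ) ≃ₗ[ℤ] (T.quotient (T.kernelSubgroup b M)).Λ :=
  LinearEquiv.ofBijective
    ((T.preimageVec b N).codRestrict ((T.kernelSubgroup b M).comap T.proj) fun y =>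
      (T.proj_mem_kernelSubgroup_iff b hMN hNM _).2 ⟨y, rfl⟩)
    ⟨fun _ _ h => T.preimageVec_injective b hMN (congrArg Subtype.val h), fun ⟨v, hv⟩ =>
      ((T.proj_mem_kernelSubgroup_iff b hMN hNM v).1 hv).imp fun _ h => Subtype.ext h⟩

theorem coe_quotientLatticeEquiv [DecidableEq ι] [DecidableEq κ] [Finite (T.kernelSubgroup b M)]
    (hMN : M.map (Int.cast : ℤ → ℝ) * N = 1) (hNM : N * M.map (Int.cast : ℤ → ℝ) = 1)
    (y : κ → ℤ) :
    (T.quotientLatticeEquiv b hMN hNM y : (T.quotient (T.kernelSubgroup b M)).V) =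
      T.preimageVec b N y := rfl

/-- The basis of the lattice of the quotient given by the columns of `M⁻¹`. -/
def quotientBasis [DecidableEq ι] [DecidableEq κ] [Finite (T.kernelSubgroup b M)]
    (hMN : M.map (Int.cast : ℤ → ℝ) * N = 1) (hNM : N * M.map (Int.cast : ℤ → ℝ) = 1) :
    Basis κ ℤ (T.quotient (T.kernelSubgroup b M)).Λ :=
  Basis.ofEquivFun (T.quotientLatticeEquiv b hMN hNM).symm

theorem lift_quotientMap (F : Submodule ℤ T.Pts) [Finite F] :
    (T.quotientMap F).lift = ContinuousLinearMap.id ℂ T.V :=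
  Hom.lift_ofLinear _ _

/-- In this basis the quotient map has the matrix `M`. -/
theorem toMatrix_homology_quotientMap [DecidableEq ι] [DecidableEq κ]
    [Finite (T.kernelSubgroup b M)]
    (hMN : M.map (Int.cast : ℤ → ℝ) * N = 1) (hNM : N * M.map (Int.cast : ℤ → ℝ) = 1) :
    LinearMap.toMatrix b (T.quotientBasis b hMN hNM)
      (T.quotientMap (T.kernelSubgroup b M)).homology = M := by
  ext k i
  rw [LinearMap.toMatrix_apply]
  have h : (T.quotientMap (T.kernelSubgroup b M)).homology (b i) =
      T.quotientLatticeEquiv b hMN hNM (M.col i) := by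
    ext
    rw [coe_quotientLatticeEquiv, T.preimageVec_eq b hNM (x := Pi.single i 1) (y := M.col i),
      ofCoords_single]
    · change (T.quotientMap (T.kernelSubgroup b M)).lift (b i) = _
      rw [lift_quotientMap]
      rfl
    · rw [Matrix.mulVec_single_one]
      rfl
  rw [h, quotientBasis, ← Basis.equivFun_apply, Basis.equivFun_ofEquivFun,
    LinearEquiv.symm_apply_apply]
  rfl

theorem isIsogeny_quotientMap (F : Submodule ℤ T.Pts) [Finite F] : (T.quotientMap F).IsIsogeny := by
  constructor
  · intro p
    obtain ⟨v, rfl⟩ := (T.quotient F).Λ.mkQ_surjective p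
    exact ⟨T.proj v, rfl⟩
  · have : ((T.quotientMap F).toAddMonoidHom.ker : Set T.Pts) = F :=
      Set.ext fun x => T.quotientMap_eq_zero_iff F x
    change Finite ((T.quotientMap F).toAddMonoidHom.ker : Set T.Pts)
    rw [this]
    infer_instance

end Kernel

theorem Hom.lift_comp {A B C : ComplexTorus.{u}} (g : Hom B C) (f : Hom A B) :
    (g.comp f).lift = g.lift.comp f.lift :=
  Hom.lift_unique _ _ fun v => by
    rw [Hom.comp_apply, f.proj_lift, g.proj_lift, ContinuousLinearMap.comp_apply]

theorem Hom.continuous {A B : ComplexTorus.{u}} (f : Hom A B) : Continuous f := by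
  refine (Submodule.isQuotientMap_mkQ A.Λ).continuous_iff.2 ?_
  have : (f : A.Pts → B.Pts) ∘ A.Λ.mkQ = B.proj ∘ f.lift := funext f.proj_lift
  rw [this]
  exact B.Λ.continuous_mkQ.comp f.lift.continuous

/-- An injective morphism with injective differential is an embedding, since complex tori are
compact Hausdorff spaces. -/
theorem Hom.isEmbedding_of_injective {ι : Type} [Fintype ι] {A B : ComplexTorus.{u}} (f : Hom A B)
    (a : Basis ι ℤ A.Λ) (h : Function.Injective f) (h' : Function.Injective f.lift) :
    f.IsEmbedding :=
  have := A.compactSpace_pts a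
  ⟨f.continuous.isClosedEmbedding h, h'⟩

end ComplexTorus

/-! ### Products, quotients and their polarizations -/

namespace ComplexTorus

variable {X X' : ComplexTorus.{u}}

theorem lift_inl (v : X.V) : (inl X X').lift v = ((v, 0) : X.V × X'.V) :=
  DFunLike.congr_fun (Hom.lift_ofLinear (Y := X.prod X') _ _) v

theorem lift_inr (v : X'.V) : (inr X X').lift v = ((0, v) : X.V × X'.V) :=
  DFunLike.congr_fun (Hom.lift_ofLinear (Y := X.prod X') _ _) v

theorem lift_inl_injective : Function.Injective (inl X X').lift := fun v w h =>
  congrArg Prod.fst ((lift_inl v).symm.trans (h.trans (lift_inl w)))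

theorem lift_inr_injective : Function.Injective (inr X X').lift := fun v w h =>
  congrArg Prod.snd ((lift_inr v).symm.trans (h.trans (lift_inr w)))

theorem lift_fst (v : (X.prod X').V) : (fst X X').lift v = Prod.fst (α := X.V) (β := X'.V) v :=
  DFunLike.congr_fun (Hom.lift_ofLinear (X := X.prod X') _ _) v

theorem lift_snd (v : (X.prod X').V) : (snd X X').lift v = Prod.snd (α := X.V) (β := X'.V) v :=
  DFunLike.congr_fun (Hom.lift_ofLinear (X := X.prod X') _ _) v

theorem homology_fst_inl (x : X.Λ) : (fst X X').homology ((inl X X').homology x) = x :=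
  Subtype.ext ((lift_fst _).trans (congrArg Prod.fst (lift_inl _)))

theorem homology_fst_inr (x : X'.Λ) : (fst X X').homology ((inr X X').homology x) = 0 :=
  Subtype.ext ((lift_fst _).trans (congrArg Prod.fst (lift_inr _)))

theorem homology_snd_inl (x : X.Λ) : (snd X X').homology ((inl X X').homology x) = 0 :=
  Subtype.ext ((lift_snd _).trans (congrArg Prod.snd (lift_inl _)))

theorem homology_snd_inr (x : X'.Λ) : (snd X X').homology ((inr X X').homology x) = x :=
  Subtype.ext ((lift_snd _).trans (congrArg Prod.snd (lift_inr _)))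

theorem prodBasis_inl {ι ι' : Type} (b : Basis ι ℤ X.Λ) (b' : Basis ι' ℤ X'.Λ) (i : ι) :
    prodBasis b b' (Sum.inl i) = (inl X X').homology (b i) :=
  (congrArg (prodLatticeEquiv X.Λ X'.Λ)
    (show b.prod b' (Sum.inl i) = (b i, 0) by ext <;> simp)).trans
    (Subtype.ext (lift_inl _).symm)

theorem prodBasis_inr {ι ι' : Type} (b : Basis ι ℤ X.Λ) (b' : Basis ι' ℤ X'.Λ) (i : ι') :
    prodBasis b b' (Sum.inr i) = (inr X X').homology (b' i) :=
  (congrArg (prodLatticeEquiv X.Λ X'.Λ)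
    (show b.prod b' (Sum.inr i) = (0, b' i) by ext <;> simp)).trans
    (Subtype.ext (lift_inr _).symm)

theorem coe_prodBasis_inl {ι ι' : Type} (b : Basis ι ℤ X.Λ) (b' : Basis ι' ℤ X'.Λ) (i : ι) :
    (prodBasis b b' (Sum.inl i) : (X.prod X').V) = ((b i, 0) : X.V × X'.V) :=
  (congrArg Subtype.val (prodBasis_inl b b' i)).trans (lift_inl _)

theorem coe_prodBasis_inr {ι ι' : Type} (b : Basis ι ℤ X.Λ) (b' : Basis ι' ℤ X'.Λ) (i : ι') :
    (prodBasis b b' (Sum.inr i) : (X.prod X').V) = ((0, b' i) : X.V × X'.V) :=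
  (congrArg Subtype.val (prodBasis_inr b b' i)).trans (lift_inr _)

theorem pair_proj (v : X.V) (w : X'.V) :
    pair (X.proj v) (X'.proj w) = (X.prod X').proj ((v, w) : X.V × X'.V) := by
  change (X.prod X').proj ((v + 0, 0 + w) : X.V × X'.V) = _
  rw [add_zero, zero_add]

/-- The polarization `p^* L_X ⊗ p'^* L_X'` of `X × X'`: the Hermitian form is the orthogonal sum of
the Hermitian forms of the factors. -/
def _root_.Polarization.prod (P : Polarization X) (P' : Polarization X') :
    Polarization (X.prod X') where
  form := P.form.comp (fst X X').homology (fst X X').homology +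
    P'.form.comp (snd X X').homology (snd X X').homology
  exists_hermitian := by
    obtain ⟨H, h, hpos, him⟩ := P.exists_hermitian
    obtain ⟨H', h', hpos', him'⟩ := P'.exists_hermitian
    let K : (X.V × X'.V) →ₗ[ℂ] (X.V × X'.V) →ₛₗ[starRingEnd ℂ] ℂ :=
      LinearMap.mk₂'ₛₗ (RingHom.id ℂ) (starRingEnd ℂ) (fun v w => H v.1 w.1 + H' v.2 w.2)
        (fun v v' w => by
          simp only [Prod.fst_add, Prod.snd_add, map_add, LinearMap.add_apply]
          ring)
        (fun c v w => by simp [mul_add])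
        (fun v w w' => by
          simp only [Prod.fst_add, Prod.snd_add, map_add]
          ring)
        (fun c v w => by simp [mul_add])
    refine ⟨K, ?_, ?_, ?_⟩
    · rintro ⟨v, v'⟩ ⟨w, w'⟩
      change H w v + H' w' v' = starRingEnd ℂ (H v w + H' v' w')
      rw [map_add, h, h']
    · rintro ⟨v, v'⟩ hv
      change 0 < (H v v + H' v' v').re
      rw [Complex.add_re]
      have h0 : ∀ v, 0 ≤ (H v v).re := fun v => by
        by_cases hv : v = 0
        · simp [hv]
        · exact (hpos v hv).le
      have h0' : ∀ v, 0 ≤ (H' v v).re := fun v => by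
        by_cases hv : v = 0
        · simp [hv]
        · exact (hpos' v hv).le
      by_cases hv0 : v = 0
      · have hv' : v' ≠ 0 := by
          rintro rfl
          exact hv (by rw [hv0]; rfl)
        exact add_pos_of_nonneg_of_pos (h0 v) (hpos' v' hv')
      · exact add_pos_of_pos_of_nonneg (hpos v hv0) (h0' v')
    · intro x y
      have e1 : ∀ z : (X.prod X').Λ, (((fst X X').homology z : X.Λ) : X.V) = z.1.1 :=
        fun z => lift_fst _
      have e2 : ∀ z : (X.prod X').Λ, (((snd X X').homology z : X'.Λ) : X'.V) = z.1.2 :=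
        fun z => lift_snd _
      change (H x.1.1 y.1.1 + H' x.1.2 y.1.2).im = _
      rw [Complex.add_im, ← e1, ← e1, ← e2, ← e2, him, him']
      exact (Int.cast_add _ _).symm

theorem _root_.Polarization.prod_form_apply (P : Polarization X) (P' : Polarization X')
    (z w : (X.prod X').Λ) :
    (P.prod P').form z w = P.form ((fst X X').homology z) ((fst X X').homology w) +
      P'.form ((snd X X').homology z) ((snd X X').homology w) := rfl

section

variable {ι ι' κ : Type} [Fintype ι] [Fintype ι'] [Fintype κ] [DecidableEq ι] [DecidableEq ι']
  {Y : ComplexTorus.{u}}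

/-- The matrix of the restriction to `X` of a morphism from `X × X'`. -/
theorem toMatrix_comp_inl (s : Hom (X.prod X') Y) (b : Basis ι ℤ X.Λ) (b' : Basis ι' ℤ X'.Λ)
    (c : Basis κ ℤ Y.Λ) :
    LinearMap.toMatrix b c (s.comp (inl X X')).homology =
      (LinearMap.toMatrix (prodBasis b b') c s.homology).submatrix id Sum.inl := by
  ext k i
  rw [LinearMap.toMatrix_apply, Matrix.submatrix_apply, LinearMap.toMatrix_apply, prodBasis_inl,
    Hom.homology_comp]
  rfl

theorem toMatrix_comp_inr (s : Hom (X.prod X') Y) (b : Basis ι ℤ X.Λ) (b' : Basis ι' ℤ X'.Λ)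
    (c : Basis κ ℤ Y.Λ) :
    LinearMap.toMatrix b' c (s.comp (inr X X')).homology =
      (LinearMap.toMatrix (prodBasis b b') c s.homology).submatrix id Sum.inr := by
  ext k i
  rw [LinearMap.toMatrix_apply, Matrix.submatrix_apply, LinearMap.toMatrix_apply, prodBasis_inr,
    Hom.homology_comp]
  rfl

omit [Fintype κ] in
theorem _root_.Polarization.toMatrix_prod (P : Polarization X) (P' : Polarization X')
    (b : Basis ι ℤ X.Λ) (b' : Basis ι' ℤ X'.Λ) :
    LinearMap.BilinForm.toMatrix (prodBasis b b') (P.prod P').form =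
      Matrix.fromBlocks (LinearMap.BilinForm.toMatrix b P.form) 0 0
        (LinearMap.BilinForm.toMatrix b' P'.form) := by
  ext i j
  rcases i with i | i <;> rcases j with j | j <;>
    simp [LinearMap.BilinForm.toMatrix_apply, Polarization.prod_form_apply, prodBasis_inl,
      prodBasis_inr, homology_fst_inl, homology_fst_inr, homology_snd_inl, homology_snd_inr]

end

/-- If the matrix of a polarization in the basis `b` is `Mᵀ A M` with `A` integral, then the
polarization descends to the quotient by the subgroup cut out by `M`, and its matrix in the basis
formed by the columns of `M⁻¹` is `A`. -/
theorem exists_polarization_quotient {ι κ : Type} [Fintype ι] [Fintype κ] [DecidableEq ι]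
    [DecidableEq κ] (T : ComplexTorus.{u}) (b : Basis ι ℤ T.Λ) {M : Matrix κ ι ℤ}
    {N : Matrix ι κ ℝ} [Finite (T.kernelSubgroup b M)]
    (hMN : M.map (Int.cast : ℤ → ℝ) * N = 1) (hNM : N * M.map (Int.cast : ℤ → ℝ) = 1)
    (P : Polarization T) (A : Matrix κ κ ℤ)
    (hP : LinearMap.BilinForm.toMatrix b P.form = Mᵀ * A * M) :
    ∃ Q : Polarization (T.quotient (T.kernelSubgroup b M)),
      LinearMap.BilinForm.toMatrix (T.quotientBasis b hMN hNM) Q.form = A := by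
  obtain ⟨H, h, hpos, him⟩ := P.exists_hermitian
  refine ⟨⟨Matrix.toBilin (T.quotientBasis b hMN hNM) A, H, h, hpos, fun x y => ?_⟩,
    LinearMap.BilinForm.toMatrix_toBilin _ _⟩
  obtain ⟨y, rfl⟩ := (T.quotientLatticeEquiv b hMN hNM).surjective y
  obtain ⟨x, rfl⟩ := (T.quotientLatticeEquiv b hMN hNM).surjective x
  have hform : Matrix.toBilin (T.quotientBasis b hMN hNM) A (T.quotientLatticeEquiv b hMN hNM x)
      (T.quotientLatticeEquiv b hMN hNM y) = x ⬝ᵥ A *ᵥ y := by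
    have := LinearMap.BilinForm.dotProduct_toMatrix_mulVec (T.quotientBasis b hMN hNM)
      (Matrix.toBilin (T.quotientBasis b hMN hNM) A) x y
    rw [LinearMap.BilinForm.toMatrix_toBilin] at this
    rw [this, quotientBasis]
    simp
  rw [hform, coe_quotientLatticeEquiv, coe_quotientLatticeEquiv]
  -- The imaginary part of `H` as a form on the real vector space `V`.
  let B : LinearMap.BilinForm ℝ T.V := LinearMap.mk₂ ℝ (fun v w => (H v w).im)
    (fun v v' w => by simp) (fun c v w => by
      rw [← Complex.coe_smul, map_smul]; simp)
    (fun v w w' => by simp) (fun c v w => by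
      rw [← Complex.coe_smul, LinearMap.map_smulₛₗ]; simp)
  have hB : LinearMap.BilinForm.toMatrix (T.realBasis b) B =
      (Mᵀ * A * M).map (Int.cast : ℤ → ℝ) := by
    ext i j
    rw [LinearMap.BilinForm.toMatrix_apply, ← hP, realBasis_apply, realBasis_apply, Matrix.map_apply,
      LinearMap.BilinForm.toMatrix_apply]
    exact him _ _
  have h1 := LinearMap.BilinForm.dotProduct_toMatrix_mulVec (T.realBasis b) B
    (N *ᵥ fun k => (x k : ℝ)) (N *ᵥ fun k => (y k : ℝ))
  change (B (T.preimageVec b N x) (T.preimageVec b N y)) = _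
  rw [preimageVec_apply, preimageVec_apply]
  refine h1.symm.trans ?_
  have hmap : (Mᵀ * A * M).map (Int.cast : ℤ → ℝ) =
      (M.map (Int.cast : ℤ → ℝ))ᵀ * A.map (Int.cast : ℤ → ℝ) * M.map (Int.cast : ℤ → ℝ) := by
    rw [map_intCast_mul, map_intCast_mul, Matrix.transpose_map]
  -- `(N x) ⬝ Mᵀ A M (N y) = x ⬝ A y`, because `M N = 1`.
  rw [hB, hmap, Matrix.mulVec_mulVec, Matrix.mul_assoc, hMN, Matrix.mul_one,
    ← Matrix.mulVec_mulVec, Matrix.dotProduct_mulVec, Matrix.vecMul_transpose,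
    Matrix.mulVec_mulVec, hMN, Matrix.one_mulVec, map_intCast_mulVec]
  simp [dotProduct]

end ComplexTorus

/-! ### Embedding matrices -/

/-- The inverse over `ℝ` of the matrix of a form of type `D`. -/
def PolarizationType.hatInv {n : ℕ} (D : PolarizationType n) :
    Matrix (Fin n ⊕ Fin n) (Fin n ⊕ Fin n) ℝ :=
  Matrix.fromBlocks 0 (-Matrix.diagonal fun i => (D.d i : ℝ)⁻¹)
    (Matrix.diagonal fun i => (D.d i : ℝ)⁻¹) 0

theorem PolarizationType.hatInv_mul_hat {n : ℕ} (D : PolarizationType n) :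
    D.hatInv * D.hat.map (Int.cast : ℤ → ℝ) = 1 := by
  have h : ∀ i, (D.d i : ℝ)⁻¹ * D.d i = 1 := fun i =>
    inv_mul_cancel₀ (Nat.cast_ne_zero.2 (D.pos i).ne')
  have h1 : (Matrix.diagonal fun i => (D.d i : ℤ)).map (Int.cast : ℤ → ℝ) =
      Matrix.diagonal fun i => (D.d i : ℝ) := by
    rw [Matrix.diagonal_map (by simp)]
    simp
  have h2 : (-Matrix.diagonal fun i => (D.d i : ℤ)).map (Int.cast : ℤ → ℝ) =
      -Matrix.diagonal fun i => (D.d i : ℝ) := by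
    rw [← h1]
    ext
    exact Int.cast_neg _
  rw [hatInv, hat, Matrix.fromBlocks_map, Matrix.fromBlocks_multiply, h1, h2]
  simp [Matrix.diagonal_mul_diagonal, h, Matrix.fromBlocks_one]

section

variable {n n' m : ℕ}

/-- The conditions that an embedding of type `(D, D', E), M` imposes on the matrix `M`, and that
suffice to construct embeddings from their factors: the pullback by `M` of the form of type `E` is
the sum of the forms of types `D` and `D'`, and the restrictions of `M` to the two summands are
primitive, i.e. only integral vectors are mapped to integral vectors. -/
structure IsEmbeddingMatrix (D : PolarizationType n) (D' : PolarizationType n')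
    (E : PolarizationType m)
    (M : Matrix (Fin m ⊕ Fin m) ((Fin n ⊕ Fin n) ⊕ (Fin n' ⊕ Fin n')) ℤ) : Prop where
  gram : Mᵀ * E.hat * M = Matrix.fromBlocks D.hat 0 0 D'.hat
  primitive_left : ∀ (x : Fin n ⊕ Fin n → ℝ) (y : Fin m ⊕ Fin m → ℤ),
    (M.submatrix id Sum.inl).map (Int.cast : ℤ → ℝ) *ᵥ x = (fun k => (y k : ℝ)) →
      ∃ z : Fin n ⊕ Fin n → ℤ, x = fun i => (z i : ℝ)
  primitive_right : ∀ (x : Fin n' ⊕ Fin n' → ℝ) (y : Fin m ⊕ Fin m → ℤ),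
    (M.submatrix id Sum.inr).map (Int.cast : ℤ → ℝ) *ᵥ x = (fun k => (y k : ℝ)) →
      ∃ z : Fin n' ⊕ Fin n' → ℤ, x = fun i => (z i : ℝ)

variable {D : PolarizationType n} {D' : PolarizationType n'}

section

variable {E : PolarizationType m}
  {M : Matrix (Fin m ⊕ Fin m) ((Fin n ⊕ Fin n) ⊕ (Fin n' ⊕ Fin n')) ℤ}

theorem BasedAbelianVariety.toMatrix_prod_form (X : BasedAbelianVariety.{u} D)
    (X' : BasedAbelianVariety.{u} D') :
    LinearMap.BilinForm.toMatrix (ComplexTorus.prodBasis X.basis X'.basis)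
      (X.str.pol.prod X'.str.pol).form = Matrix.fromBlocks D.hat 0 0 D'.hat := by
  rw [Polarization.toMatrix_prod, X.str.symplectic, X'.str.symplectic]

theorem IsEmbeddingOfType.isEmbeddingMatrix {X : BasedAbelianVariety.{u} D}
    {X' : BasedAbelianVariety.{u} D'} {Y : BasedAbelianVariety.{u} E}
    {s : ComplexTorus.Hom (X.torus.prod X'.torus) Y.torus} (h : IsEmbeddingOfType M X X' Y s) :
    IsEmbeddingMatrix D D' E M where
  gram := by
    have h1 : Y.form.comp s.homology s.homology = (X.str.pol.prod X'.str.pol).form :=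
      LinearMap.ext₂ h.complementary
    rw [← X.toMatrix_prod_form X', ← h1, LinearMap.BilinForm.toMatrix_comp Y.basis, h.matrix,
      Y.str.symplectic]
  primitive_left := by
    have := (ComplexTorus.Hom.injective_iff _ X.basis Y.basis).1 h.embedding_left.1.injective
    rwa [ComplexTorus.toMatrix_comp_inl s X.basis X'.basis Y.basis, h.matrix] at this
  primitive_right := by
    have := (ComplexTorus.Hom.injective_iff _ X'.basis Y.basis).1 h.embedding_right.1.injective
    rwa [ComplexTorus.toMatrix_comp_inr s X.basis X'.basis Y.basis, h.matrix] at this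

theorem IsTypeOfEmbeddings.isEmbeddingMatrix (h : IsTypeOfEmbeddings.{u} D D' E M) :
    IsEmbeddingMatrix D D' E M := by
  obtain ⟨c⟩ := h
  obtain ⟨a, -⟩ := Quotient.exists_rep c
  exact a.ofType.isEmbeddingMatrix

end

variable {E : PolarizationType (n + n')}
  {M : Matrix (Fin (n + n') ⊕ Fin (n + n')) ((Fin n ⊕ Fin n) ⊕ (Fin n' ⊕ Fin n')) ℤ}

theorem card_index_eq (n n' : ℕ) : Fintype.card ((Fin n ⊕ Fin n) ⊕ (Fin n' ⊕ Fin n')) =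
    Fintype.card (Fin (n + n') ⊕ Fin (n + n')) := by
  simp only [Fintype.card_sum, Fintype.card_fin]
  omega

/-- An embedding matrix is invertible over `ℝ`, because the forms of types `D` and `D'` are
nondegenerate. -/
theorem IsEmbeddingMatrix.exists_inverse (h : IsEmbeddingMatrix D D' E M) :
    ∃ N : Matrix ((Fin n ⊕ Fin n) ⊕ (Fin n' ⊕ Fin n')) (Fin (n + n') ⊕ Fin (n + n')) ℝ,
      M.map (Int.cast : ℤ → ℝ) * N = 1 ∧ N * M.map (Int.cast : ℤ → ℝ) = 1 := by
  have hl : Matrix.fromBlocks D.hatInv 0 0 D'.hatInv * (Mᵀ * E.hat).map (Int.cast : ℤ → ℝ) *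
      M.map (Int.cast : ℤ → ℝ) = 1 := by
    rw [Matrix.mul_assoc, ← ComplexTorus.map_intCast_mul, h.gram, Matrix.fromBlocks_map,
      Matrix.fromBlocks_multiply]
    simp [PolarizationType.hatInv_mul_hat, Matrix.fromBlocks_one]
  exact ⟨_, (Matrix.mul_eq_one_comm_of_equiv (Fintype.equivOfCardEq (card_index_eq n n'))).1 hl, hl⟩

/-! ### Construction of the embedding from its factors -/

/-- The quotient map `X × X' → (X × X') / F` is an embedding of type `M` for a suitable symplectic
basis of the quotient. -/
theorem IsEmbeddingMatrix.exists_isEmbeddingOfType (h : IsEmbeddingMatrix D D' E M)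
    (X : BasedAbelianVariety.{u} D) (X' : BasedAbelianVariety.{u} D')
    [Finite (embeddingKernel M X X')] :
    ∃ σ : SymplecticPolarization
        ((X.torus.prod X'.torus).quotient (embeddingKernel M X X')) E,
      IsEmbeddingOfType M X X'
        ⟨(X.torus.prod X'.torus).quotient (embeddingKernel M X X'), σ⟩
        ((X.torus.prod X'.torus).quotientMap (embeddingKernel M X X')) := by
  obtain ⟨N, hMN, hNM⟩ := h.exists_inverse
  set T := X.torus.prod X'.torus
  set b := ComplexTorus.prodBasis X.basis X'.basis
  have : Finite (T.kernelSubgroup b M) := ‹Finite (embeddingKernel M X X')›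
  let s := T.quotientMap (embeddingKernel M X X')
  let c : Basis _ ℤ (T.quotient (embeddingKernel M X X')).Λ := T.quotientBasis b hMN hNM
  obtain ⟨Q, hQ⟩ : ∃ Q : Polarization (T.quotient (embeddingKernel M X X')),
      LinearMap.BilinForm.toMatrix c Q.form = E.hat :=
    T.exists_polarization_quotient b hMN hNM (X.str.pol.prod X'.str.pol) E.hat
      (by rw [h.gram, X.toMatrix_prod_form])
  have hs : LinearMap.toMatrix b c s.homology = M := T.toMatrix_homology_quotientMap b hMN hNM
  -- Both forms have the matrix `Mᵀ Ê M` in the basis `b`.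
  have hcompl : ∀ z w, Q.form (s.homology z) (s.homology w) =
      (X.str.pol.prod X'.str.pol).form z w := by
    have : Q.form.comp s.homology s.homology = (X.str.pol.prod X'.str.pol).form := by
      refine (LinearMap.BilinForm.toMatrix b).injective ?_
      rw [LinearMap.BilinForm.toMatrix_comp c, hs, X.toMatrix_prod_form, hQ, h.gram]
    exact fun z w => LinearMap.congr_fun₂ this z w
  have hlift : Function.Injective s.lift := by
    rw [show s.lift = ContinuousLinearMap.id ℂ T.V from T.lift_quotientMap _]
    exact Function.injective_id
  refine ⟨⟨Q, c, hQ⟩, T.isIsogeny_quotientMap _, ?_, ?_, ?_, ?_, hcompl, hs⟩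
  · refine ComplexTorus.Hom.isEmbedding_of_injective _ X.basis ?_ ?_
    · rw [ComplexTorus.Hom.injective_iff _ X.basis c,
        ComplexTorus.toMatrix_comp_inl s X.basis X'.basis c, hs]
      exact h.primitive_left
    · rw [ComplexTorus.Hom.lift_comp]
      exact hlift.comp ComplexTorus.lift_inl_injective
  · refine ComplexTorus.Hom.isEmbedding_of_injective _ X'.basis ?_ ?_
    · rw [ComplexTorus.Hom.injective_iff _ X'.basis c,
        ComplexTorus.toMatrix_comp_inr s X.basis X'.basis c, hs]
      exact h.primitive_right
    · rw [ComplexTorus.Hom.lift_comp]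
      exact hlift.comp ComplexTorus.lift_inr_injective
  · intro x y
    rw [ComplexTorus.Hom.homology_comp, ComplexTorus.Hom.homology_comp]
    refine (hcompl _ _).trans ?_
    rw [Polarization.prod_form_apply]
    simp only [ComplexTorus.homology_fst_inl, ComplexTorus.homology_snd_inl, map_zero, add_zero]
  · intro x y
    rw [ComplexTorus.Hom.homology_comp, ComplexTorus.Hom.homology_comp]
    refine (hcompl _ _).trans ?_
    rw [Polarization.prod_form_apply]
    simp only [ComplexTorus.homology_fst_inr, ComplexTorus.homology_snd_inr, map_zero,
      zero_add]

/-! ### Uniqueness of the embedding with given factors -/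

/-- Between abelian varieties with symplectic bases of the same type, an isomorphism that preserves
the bases preserves the polarizations. -/
theorem BasedAbelianVariety.preserves_of_basis {n : ℕ} {D : PolarizationType n}
    {X Y : BasedAbelianVariety.{u} D}
    (e : ComplexTorus.Iso X.torus Y.torus) (h : ∀ i, e.hom.homology (X.basis i) = Y.basis i) :
    BasedAbelianVariety.Preserves e := by
  refine ⟨fun x y => ?_, h⟩
  have : Y.form.comp e.hom.homology e.hom.homology = X.form := by
    refine (LinearMap.BilinForm.toMatrix X.basis).injective ?_
    rw [X.str.symplectic, ← Y.str.symplectic]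
    ext i j
    rw [LinearMap.BilinForm.toMatrix_apply, LinearMap.BilinForm.toMatrix_apply,
      LinearMap.BilinForm.comp_apply, h, h]
  exact LinearMap.congr_fun₂ this x y

/-- Isomorphisms of the factors extend to an isomorphism of the embeddings: as the differential of
`s` is invertible, the isomorphism `u × u'` descends to an isomorphism of the vector spaces that
cover the targets, and it respects the symplectic bases since both isogenies have the matrix
`M`. -/
theorem EmbeddingDatum.toClass_eq_of_factors (a a' : EmbeddingDatum.{u} D D' E M)
    (hX : a.X.toClass = a'.X.toClass) (hX' : a.X'.toClass = a'.X'.toClass) :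
    a.toClass = a'.toClass := by
  obtain ⟨u, hu⟩ := Quotient.exact hX
  obtain ⟨u', hu'⟩ := Quotient.exact hX'
  obtain ⟨N, hMN, hNM⟩ := a.ofType.isEmbeddingMatrix.exists_inverse
  let b := ComplexTorus.prodBasis a.X.basis a.X'.basis
  let b' := ComplexTorus.prodBasis a'.X.basis a'.X'.basis
  have hbij : Function.Bijective a.s.lift :=
    a.s.bijective_lift b a.Y.basis N (by rw [a.ofType.matrix, hMN]) (by rw [a.ofType.matrix, hNM])
  let S : (a.X.torus.prod a.X'.torus).V ≃ₗ[ℂ] a.Y.torus.V :=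
    LinearEquiv.ofBijective a.s.lift.toLinearMap hbij
  let U : (a.X.torus.prod a.X'.torus).V →L[ℂ] (a'.X.torus.prod a'.X'.torus).V :=
    ContinuousLinearMap.prodMap u.hom.lift u'.hom.lift
  let F : a.Y.torus.V →L[ℂ] a'.Y.torus.V :=
    (a'.s.lift.comp U).comp S.symm.toLinearMap.toContinuousLinearMap
  have hFs : ∀ v, F (a.s.lift v) = a'.s.lift (U v) := fun v =>
    congrArg (fun w => a'.s.lift (U w)) (S.symm_apply_apply v)
  have hU : ∀ i, U (b i) = b' i := by
    rintro (i | i)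
    · rw [ComplexTorus.coe_prodBasis_inl, ComplexTorus.coe_prodBasis_inl, ← hu.2 i]
      exact Prod.ext rfl (map_zero u'.hom.lift)
    · rw [ComplexTorus.coe_prodBasis_inr, ComplexTorus.coe_prodBasis_inr, ← hu'.2 i]
      exact Prod.ext (map_zero u.hom.lift) rfl
  have hUx := ComplexTorus.map_ofCoords U b b' hU
  have hF : ∀ k, F (a.Y.basis k) = a'.Y.basis k := by
    intro k
    rw [← ComplexTorus.ofCoords_single, ← ComplexTorus.ofCoords_single]
    -- The vector with coordinates `y` on either target comes from coordinates `M⁻¹ y` on the source.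
    have h1 : ∀ y, F (a.Y.torus.ofCoords a.Y.basis y) = a'.Y.torus.ofCoords a'.Y.basis y := by
      intro y
      have e1 := a.s.lift_ofCoords b a.Y.basis (N *ᵥ y)
      have e2 := a'.s.lift_ofCoords b' a'.Y.basis (N *ᵥ y)
      rw [a.ofType.matrix, Matrix.mulVec_mulVec, hMN, Matrix.one_mulVec] at e1
      rw [a'.ofType.matrix, Matrix.mulVec_mulVec, hMN, Matrix.one_mulVec] at e2
      rw [← e1, hFs, hUx, e2]
    exact h1 _
  obtain ⟨v, hv, hvb⟩ := ComplexTorus.exists_iso_of_basis F a.Y.basis a'.Y.basis hF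
  refine Quotient.sound ⟨u, u', v, hu, hu', BasedAbelianVariety.preserves_of_basis v hvb, ?_⟩
  intro x x'
  obtain ⟨x, rfl⟩ := a.X.torus.Λ.mkQ_surjective x
  obtain ⟨x', rfl⟩ := a.X'.torus.Λ.mkQ_surjective x'
  change a'.s (ComplexTorus.pair (u.hom (a.X.torus.proj x)) (u'.hom (a.X'.torus.proj x'))) =
    v.hom (a.s (ComplexTorus.pair (a.X.torus.proj x) (a.X'.torus.proj x')))
  rw [u.hom.proj_lift, u'.hom.proj_lift, ComplexTorus.pair_proj, ComplexTorus.pair_proj]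
  refine (a'.s.proj_lift _).trans ?_
  refine Eq.trans ?_ (congrArg v.hom (a.s.proj_lift _)).symm
  let z : (a.X.torus.prod a.X'.torus).V := ((x, x') : a.X.torus.V × a.X'.torus.V)
  exact (congrArg a'.Y.torus.proj (hFs z)).symm.trans (hv _).symm

end

end

/-! ### The bijection between embeddings and pairs of factors -/

theorem mainTheorem5 {n n' : ℕ} (D : PolarizationType n) (D' : PolarizationType n')
    (E : PolarizationType (n + n'))
    (M : Matrix (Fin (n + n') ⊕ Fin (n + n')) ((Fin n ⊕ Fin n) ⊕ (Fin n' ⊕ Fin n')) ℤ)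
    (hM : IsTypeOfEmbeddings.{u} D D' E M) :
    ∃ Φ : EmbeddingClass.{u} D D' E M ≃
        BasedAbelianVarietyClass.{u} D × BasedAbelianVarietyClass.{u} D',
      (∀ a : EmbeddingDatum.{u} D D' E M, Φ a.toClass = (a.X.toClass, a.X'.toClass)) ∧
      ∀ (X : BasedAbelianVariety.{u} D) (X' : BasedAbelianVariety.{u} D'),
        (∃ φ : ((Fin (n + n') ⊕ Fin (n + n') → ℤ) ⧸ LinearMap.range M.mulVecLin) ≃ₗ[ℤ]
            embeddingKernel M X X',
          ∀ (x : (Fin n ⊕ Fin n) ⊕ (Fin n' ⊕ Fin n') → ℝ) (y : Fin (n + n') ⊕ Fin (n + n') → ℤ),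
            M.map (Int.cast : ℤ → ℝ) *ᵥ x = (fun i => (y i : ℝ)) →
              (φ (Submodule.Quotient.mk y) : (X.torus.prod X'.torus).Pts) =
                (X.torus.prod X'.torus).proj
                  (∑ j, x j • (ComplexTorus.prodBasis X.basis X'.basis j :
                    (X.torus.prod X'.torus).V))) ∧
        ∃ (_ : Finite (embeddingKernel M X X'))
          (σ : SymplecticPolarization
            ((X.torus.prod X'.torus).quotient (embeddingKernel M X X')) E)
          (h : IsEmbeddingOfType M X X'
            ⟨(X.torus.prod X'.torus).quotient (embeddingKernel M X X'), σ⟩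
            ((X.torus.prod X'.torus).quotientMap (embeddingKernel M X X'))),
          Φ.symm (X.toClass, X'.toClass) =
            EmbeddingDatum.toClass ⟨X, X', _, _, h⟩ := by
  let f : EmbeddingClass.{u} D D' E M →
      BasedAbelianVarietyClass.{u} D × BasedAbelianVarietyClass.{u} D' :=
    Quotient.lift (fun a => (a.X.toClass, a.X'.toClass)) fun a a' ⟨u, u', _, hu, hu', _⟩ =>
      Prod.ext (Quotient.sound ⟨u, hu⟩) (Quotient.sound ⟨u', hu'⟩)
  have hf : ∀ a : EmbeddingDatum.{u} D D' E M, f a.toClass = (a.X.toClass, a.X'.toClass) :=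
    fun _ => rfl
  have h := hM.isEmbeddingMatrix
  obtain ⟨N, hMN, hNM⟩ := h.exists_inverse
  have hfin : ∀ (X : BasedAbelianVariety.{u} D) (X' : BasedAbelianVariety.{u} D'),
      Finite (embeddingKernel M X X') := fun X X' =>
    (X.torus.prod X'.torus).finite_kernelSubgroup _ hMN hNM (card_index_eq n n')
  have hbij : Function.Bijective f := by
    constructor
    · intro c c'
      refine Quotient.inductionOn₂ c c' fun a a' haa' => ?_
      obtain ⟨h1, h2⟩ := Prod.ext_iff.1 haa'
      exact a.toClass_eq_of_factors a' h1 h2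
    · rintro ⟨c, c'⟩
      obtain ⟨X, rfl⟩ := Quotient.exists_rep c
      obtain ⟨X', rfl⟩ := Quotient.exists_rep c'
      have := hfin X X'
      obtain ⟨σ, hσ⟩ := h.exists_isEmbeddingOfType X X'
      exact ⟨EmbeddingDatum.toClass ⟨X, X', _, _, hσ⟩, rfl⟩
  refine ⟨Equiv.ofBijective f hbij, hf, fun X X' => ⟨?_, hfin X X', ?_⟩⟩
  · exact (X.torus.prod X'.torus).exists_coker_equiv_kernelSubgroup _ hMN hNM
  · have := hfin X X'
    obtain ⟨σ, hσ⟩ := h.exists_isEmbeddingOfType X X'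
    exact ⟨σ, hσ, (Equiv.symm_apply_eq _).2 rfl⟩
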